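/- Let $(\zeta(t))_{t\ge 0}$ be a càdlàg process with values in $\mathbb{R}^d$, given by a measurable family of laws $(P_x)_{x\in\mathbb{R}^d}$ on the space of càdlàg paths, where $P_x$ is the law of $\zeta$ given $\zeta(0)=x$. Let $\lambda:\mathbb{R}^d\to\mathbb{R}_+$ be measurable and bounded, with $\int_0^{\infty}\lambda(\zeta(v))\,dv=+\infty$ $P_x$-almost surely for every $x$, let $Q(z;dz_1)$ be a transition probability on $\mathbb{R}^d$, and set $$M(\zeta;dz,dv)=\lambda(\zeta(v))\,e^{-\int_0^v\lambda(\zeta(w))\,dw}\,Q(\zeta(v);dz)\,dv .$$ A process $(X_t)_{t\ge 0}$ is a switching process associated with $\zeta$ and $M$, with initial law $\mu_0$, if there are random variables $T_0=0$, $Y_0\sim\mu_0$, and, for $n\ge 0$, $\zeta^{(n+1)},Y_{n+1},T_{n+1}$ on its probability space such that 1. given $Y_0,\dots,Y_n,\,T_0,\dots,T_n,\,\zeta^{(1)},\dots,\zeta^{(n)}$, the path $\zeta^{(n+1)}$ has law $P_{Y_n}$; 2. given in addition $\zeta^{(n+1)}$, the pair $(Y_{n+1},T_{n+1}-T_n)$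 has law $M(\zeta^{(n+1)};dz,dv)$; 3. almost surely, for all $n$, $X_t=\zeta^{(n+1)}(t-T_n)$ whenever $T_n\le t<T_{n+1}$, and $X_{T_{n+1}}=Y_{n+1}$. (A fixed initial state $x_0$ is the case $\mu_0=\delta_{x_0}$.) Let $\mathcal{A}$ be an operator with domain $\mathcal{D}(\mathcal{A})$, a set of bounded measurable real functions on $\mathbb{R}^d$, such that for every $f\in\mathcal{D}(\mathcal{A})$ the function $\mathcal{A}f$ is measurable and bounded on $\mathbb{R}^d$ and, for every $x$, $$M^f_t=f(\zeta(t))-f(\zeta(0))-\int_0^t\mathcal{A}f(\zeta(v))\,dv$$ is a martingale under $P_x$ for the natural filtration of $\zeta$. Let $\Psi$ be a switching process associated with $\zeta$ and $M$, with any initial law, let $f\in\mathcal{D}(\mathcal{A})$, and put $$\tilde{\mathcal{A}}f(z)=\mathcal{A}f(z)+\lambda(z)\int_{\mathbb{R}^d}\bigl(f(z_1)-f(z)\bigr)\,Q(z;dz_1).$$ Then, for every $t\ge 0$, all the expectations and integrals below are well defined (the integrands are integrable) and $$\mathbb{E}\bigl(f(\Psi_t)\bigr)=\mathbb{E}\bigl(f(\Psi_0)\bigr)+\int_0^t\mathbb{E}\bigl(\tilde{\mathcal{A}}f(\Psi_s)\bigr)\,ds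 .$$ -/

import Mathlib

open MeasureTheory ProbabilityTheory Filter Topology Set
open scoped NNReal ENNReal

/-- The state space `ℝ^d`. -/
abbrev State (d : ℕ) : Type := EuclideanSpace ℝ (Fin d)

/-- A path `ω : ℝ₊ → ℝ^d` is càdlàg: right-continuous with left limits. -/
def IsCadlag {d : ℕ} (ω : ℝ≥0 → State d) : Prop :=
  ∀ t, ContinuousWithinAt ω (Ici t) t ∧ ∃ l, Tendsto ω (𝓝[<] t) (𝓝 l)

/-- The space of càdlàg paths in `ℝ^d`. -/
structure CadlagPath (d : ℕ) : Type where
  /-- the underlying function -/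
  toFun : ℝ≥0 → State d
  isCadlag : IsCadlag toFun

instance (d : ℕ) : CoeFun (CadlagPath d) (fun _ => ℝ≥0 → State d) := ⟨CadlagPath.toFun⟩

/-- The σ-algebra generated by the coordinate maps `ω ↦ ω t`. -/
instance (d : ℕ) : MeasurableSpace (CadlagPath d) :=
  MeasurableSpace.comap (fun ω : CadlagPath d => (ω : ℝ≥0 → State d)) MeasurableSpace.pi

theorem CadlagPath.measurable_eval {d : ℕ} (t : ℝ≥0) :
    Measurable (fun ω : CadlagPath d => ω t) :=
  (measurable_pi_apply t).comp (comap_measurable _)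

/-- The evaluation `(ω, v) ↦ ω v` is jointly measurable (by right-continuity of paths). -/
theorem CadlagPath.measurable_eval_prod (d : ℕ) :
    Measurable (fun p : CadlagPath d × ℝ≥0 => p.1 p.2) := by
  have hmeas : ∀ n : ℕ, Measurable (fun p : CadlagPath d × ℝ≥0 =>
      p.1 (((⌊p.2 * (n + 1 : ℕ)⌋₊ : ℝ≥0) + 1) / (n + 1 : ℕ))) := by
    intro n
    have h1 : Measurable (fun q : CadlagPath d × ℕ =>
        q.1 (((q.2 : ℝ≥0) + 1) / (n + 1 : ℕ))) :=
      measurable_from_prod_countable_left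
        (fun k => CadlagPath.measurable_eval (((k : ℝ≥0) + 1) / (n + 1 : ℕ)))
    have h2 : Measurable (fun p : CadlagPath d × ℝ≥0 =>
        (p.1, ⌊p.2 * (n + 1 : ℕ)⌋₊)) :=
      measurable_fst.prodMk (Nat.measurable_floor.comp (measurable_snd.mul_const _))
    exact h1.comp h2
  refine measurable_of_tendsto_metrizable hmeas ?_
  rw [tendsto_pi_nhds]
  rintro ⟨ω, v⟩
  have hlo : ∀ n : ℕ, v ≤ ((⌊v * (n + 1 : ℕ)⌋₊ : ℝ≥0) + 1) / (n + 1 : ℕ) := by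
    intro n
    rw [le_div_iff₀ (by positivity)]
    exact (Nat.lt_floor_add_one _).le
  have hhi : ∀ n : ℕ, ((⌊v * (n + 1 : ℕ)⌋₊ : ℝ≥0) + 1) / (n + 1 : ℕ)
      ≤ v + 1 / ((n : ℝ≥0) + 1) := by
    intro n
    rw [div_le_iff₀ (by positivity), add_mul]
    push_cast
    rw [one_div, inv_mul_cancel₀ (by positivity)]
    gcongr
    exact_mod_cast Nat.floor_le (zero_le (a := v * ((n : ℝ≥0) + 1)))
  have hlim : Tendsto (fun n : ℕ => ((⌊v * (n + 1 : ℕ)⌋₊ : ℝ≥0) + 1) / (n + 1 : ℕ))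
      atTop (𝓝[≥] v) := by
    refine tendsto_nhdsWithin_iff.2 ⟨?_, Eventually.of_forall hlo⟩
    refine tendsto_of_tendsto_of_tendsto_of_le_of_le tendsto_const_nhds ?_ hlo hhi
    simpa using tendsto_const_nhds.add
      (tendsto_one_div_add_atTop_nhds_zero_nat (𝕜 := ℝ≥0))
  exact (ω.isCadlag v).1.tendsto.comp hlim

/-- The canonical (natural) filtration of the coordinate process. -/
noncomputable def canonicalFiltration (d : ℕ) :
    Filtration ℝ≥0 (inferInstance : MeasurableSpace (CadlagPath d)) :=
  Filtration.natural (fun t (ω : CadlagPath d) => ω t)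
    (fun t => (CadlagPath.measurable_eval t).stronglyMeasurable)

/-- Lebesgue measure `dv` on `ℝ₊`. -/
noncomputable def lebesgueTime : Measure ℝ≥0 :=
  ((volume : Measure ℝ).restrict (Ici 0)).map Real.toNNReal

instance : SFinite lebesgueTime := by
  unfold lebesgueTime
  infer_instance

/-- The kernel `ω ↦ lam (ω v) exp (-∫₀ᵛ lam (ω w) dw) dv` on `ℝ₊`. -/
noncomputable def hazardKernel {d : ℕ} (lam : State d → ℝ≥0) : Kernel (CadlagPath d) ℝ≥0 :=
  (Kernel.const (CadlagPath d) lebesgueTime).withDensity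
    (fun ω v =>
      ((lam (ω v) *
        (Real.exp (-∫ w in (0 : ℝ)..v, (lam (ω w.toNNReal) : ℝ))).toNNReal : ℝ≥0) : ℝ≥0∞))

/-- The kernel
`M(ω; dx, dv) = lam (ω v) exp (-∫₀ᵛ lam (ω w) dw) Q(ω v; dx) dv` on `ℝ^d × ℝ₊`. -/
noncomputable def switchKernel {d : ℕ} (lam : State d → ℝ≥0) (Q : Kernel (State d) (State d)) :
    Kernel (CadlagPath d) (State d × ℝ≥0) :=
  ((hazardKernel lam) ⊗ₖ
    (Q.comap (fun p : CadlagPath d × ℝ≥0 => p.1 p.2) (CadlagPath.measurable_eval_prod d))).map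
      Prod.swap

/-- The values of the variables of the construction before `ζ n` is drawn:
`ζ 0, …, ζ (n-1)`, `Y 0, …, Y n`, `T 0, …, T n`. -/
abbrev History (d n : ℕ) : Type :=
  (Fin n → CadlagPath d) × (Fin (n + 1) → State d) × (Fin (n + 1) → ℝ≥0)

/-- The history before `ζ n` is drawn, as a random variable. -/
def history {Ω : Type*} {d : ℕ} (ζ : ℕ → Ω → CadlagPath d) (Y : ℕ → Ω → State d)
    (T : ℕ → Ω → ℝ≥0) (n : ℕ) (ω : Ω) : History d n :=
  (fun k => ζ k ω, fun k => Y k ω, fun k => T k ω)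

theorem History.measurable_last (d n : ℕ) :
    Measurable (fun h : History d n => h.2.1 (Fin.last n)) := by
  fun_prop

theorem History.measurable_path (d n : ℕ) :
    Measurable (fun q : History d n × CadlagPath d => q.2) := measurable_snd

/-- `X` is a switching process with initial law `μ₀`, built from the intrinsic process whose law
started from `x` is `P x` and from the kernel `M = switchKernel lam Q`.

`ζ n`, for `n ≥ 0`, is the copy of the intrinsic process followed between the jump times
`T n` and `T (n + 1)`, and `Y n` is the position at time `T n`; `T 0 = 0` and `Y 0` is the initial
state. The difference `T (n + 1) - T n` is truncated, but as `M` does not charge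
`{v = 0}` its conditional law forces `T n < T (n + 1)` almost surely. -/
def IsSwitchingProcess {Ω : Type*} [MeasurableSpace Ω] (Pr : Measure Ω) {d : ℕ}
    (P : Kernel (State d) (CadlagPath d)) (lam : State d → ℝ≥0) (Q : Kernel (State d) (State d))
    (μ₀ : Measure (State d)) (X : ℝ≥0 → Ω → State d) : Prop :=
  ∃ (ζ : ℕ → Ω → CadlagPath d) (Y : ℕ → Ω → State d) (T : ℕ → Ω → ℝ≥0),
    HasLaw (Y 0) μ₀ Pr ∧
    (∀ᵐ ω ∂Pr, T 0 ω = 0) ∧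
    (∀ n, HasCondDistrib (ζ n) (history ζ Y T n)
      (P.comap (fun h : History d n => h.2.1 (Fin.last n)) (History.measurable_last d n)) Pr) ∧
    (∀ n, HasCondDistrib (fun ω => (Y (n + 1) ω, T (n + 1) ω - T n ω))
      (fun ω => (history ζ Y T n ω, ζ n ω))
      ((switchKernel lam Q).comap (fun q : History d n × CadlagPath d => q.2)
        (History.measurable_path d n)) Pr) ∧
    (∀ᵐ ω ∂Pr, ∀ n,
      (∀ t, T n ω ≤ t → t < T (n + 1) ω → X t ω = ζ n ω (t - T n ω)) ∧
      X (T (n + 1) ω) ω = Y (n + 1) ω)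

/-- The process `M^f_t = f(ζ(t)) - f(ζ(0)) - ∫₀ᵗ h(ζ(v)) dv` on the space of paths. -/
noncomputable def dynkinProcess {d : ℕ} (f h : State d → ℝ) (t : ℝ≥0) (ω : CadlagPath d) : ℝ :=
  f (ω t) - f (ω 0) - ∫ v in (0 : ℝ)..t, h (ω v.toNNReal)

/-- `𝒜̃ f (z) = 𝒜 f (z) + lam z ∫ (f z₁ - f z) Q(z; dz₁)`, where `h` stands for `𝒜 f`. -/
noncomputable def switchedGenerator {d : ℕ} (lam : State d → ℝ≥0)
    (Q : Kernel (State d) (State d)) (f h : State d → ℝ) (z : State d) : ℝ :=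
  h z + lam z * ∫ z₁, (f z₁ - f z) ∂(Q z)

/-! Write `g` for the switched generator applied to `f`, and cut `[0, t]` at the jump times. The
increment of `f(Ψ)` minus the integral of `g(Ψ)` between `min t (T n)` and `min t (T (n + 1))` has
mean zero for every `n`; these increments telescope, and `n → ∞` gives the formula.

For one increment, condition on the history and put `R = t - T n`. Averaging over the jump leaves a
functional of the intrinsic path alone. Let `D_v` be the jump density along the path and `N` the
Dynkin martingale of `f` and `A f`. Integration by parts against the survival function cancels the
jump part of `g` against the mean effect of the jump, and the functional becomes `N_R - ∫₀ᴿ D_v (N_R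
- N_v) dv` (`integral_excursion_identity`). Since `D_v` depends only on the path up to `v`, it is
orthogonal to `N_R - N_v`, so the mean is zero (`integral_dynkinProcess_sub_integral_jumpDensity`).
`integrable_and_integral_excursion` carries this over to the conditional laws of the construction.

The limit needs `T n → ∞`. A bound `C` on the rate bounds the density, so each waiting time
multiplies `E exp(-θ T n)` by at most `C / θ`, which is below 1 for `θ = C + 1`. As `f` and `g` are
bounded, dominated convergence concludes. -/

/-! ### Measurability in path and time; stopped paths -/

theorem CadlagPath.measurable_realTime {d : ℕ} (ω : CadlagPath d) :
    Measurable (fun v : ℝ => ω v.toNNReal) :=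
  (CadlagPath.measurable_eval_prod d).comp (measurable_const.prodMk measurable_real_toNNReal)

theorem intervalIntegrable_of_bounded {k : ℝ → ℝ} (hk : Measurable k) {C : ℝ}
    (hC : ∀ v, |k v| ≤ C) (a b : ℝ) : IntervalIntegrable k volume a b := by
  rw [intervalIntegrable_iff]
  exact Measure.integrableOn_of_bounded (M := C) (by simp) hk.aestronglyMeasurable
    (ae_of_all _ hC)

theorem CadlagPath.measurable_integral_eval {d : ℕ} {k : State d → ℝ} (hk : Measurable k) :
    Measurable (fun p : CadlagPath d × ℝ≥0 => ∫ w in (0 : ℝ)..p.2, k (p.1 w.toNNReal)) := by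
  -- Moving the variable endpoint into an indicator gives an integral against a fixed measure, to
  -- which parametric measurability applies.
  have h1 : Measurable (fun q : (CadlagPath d × ℝ≥0) × ℝ =>
      (Ioc (0 : ℝ) q.1.2).indicator (fun w => k (q.1.1 w.toNNReal)) q.2) := by
    have h2 : Measurable (fun q : (CadlagPath d × ℝ≥0) × ℝ => k (q.1.1 q.2.toNNReal)) :=
      hk.comp ((CadlagPath.measurable_eval_prod d).comp
        (measurable_fst.fst.prodMk (measurable_real_toNNReal.comp measurable_snd)))
    have hs : MeasurableSet {q : (CadlagPath d × ℝ≥0) × ℝ | q.2 ∈ Ioc (0 : ℝ) q.1.2} :=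
      (measurableSet_lt measurable_const measurable_snd).inter
        (measurableSet_le measurable_snd measurable_fst.snd.coe_nnreal_real)
    exact h2.indicator hs
  have h3 := (h1.stronglyMeasurable.integral_prod_right' (ν := (volume : Measure ℝ))).measurable
  convert h3 using 2 with p
  rw [intervalIntegral.integral_of_le p.2.coe_nonneg]
  exact (integral_indicator measurableSet_Ioc).symm

theorem IsCadlag.comp_min {d : ℕ} {ω : ℝ≥0 → State d} (h : IsCadlag ω) (s : ℝ≥0) :
    IsCadlag (fun t => ω (min t s)) := by
  intro t
  rcases lt_or_ge t s with hts | hst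
  · have heq : (fun t => ω (min t s)) =ᶠ[𝓝 t] ω := by
      filter_upwards [Iio_mem_nhds hts] with u hu
      rw [min_eq_left (le_of_lt hu)]
    obtain ⟨l, hl⟩ := (h t).2
    refine ⟨(h t).1.congr_of_eventuallyEq (heq.filter_mono nhdsWithin_le_nhds) heq.eq_of_nhds,
      l, hl.congr' (heq.filter_mono nhdsWithin_le_nhds).symm⟩
  · constructor
    · refine (continuousWithinAt_const (b := ω s)).congr (fun u hu => ?_) ?_
      · rw [min_eq_right (hst.trans hu)]
      · rw [min_eq_right hst]
    · rcases hst.eq_or_lt with rfl | hst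
      · obtain ⟨l, hl⟩ := (h s).2
        refine ⟨l, hl.congr' ?_⟩
        filter_upwards [self_mem_nhdsWithin] with u hu
        rw [min_eq_left (le_of_lt hu)]
      · refine ⟨ω s, tendsto_const_nhds.congr' ?_⟩
        filter_upwards [mem_nhdsWithin_of_mem_nhds (Ioi_mem_nhds hst)] with u hu
        rw [min_eq_right (le_of_lt hu)]

/-- The path stopped at the deterministic time `s`. -/
def CadlagPath.stopAt {d : ℕ} (s : ℝ≥0) (ω : CadlagPath d) : CadlagPath d :=
  ⟨fun t => ω (min t s), ω.isCadlag.comp_min s⟩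

theorem CadlagPath.measurable_stopAt {d : ℕ} (s : ℝ≥0) :
    Measurable[canonicalFiltration d s] (CadlagPath.stopAt (d := d) s) := by
  rw [measurable_comap_iff]
  refine @measurable_pi_lambda _ _ _ (canonicalFiltration d s) _ _ fun t => ?_
  have h := (Filtration.stronglyAdapted_natural (u := fun t (ω : CadlagPath d) => ω t)
    (fun t => (CadlagPath.measurable_eval t).stronglyMeasurable) (min t s)).measurable
  exact h.mono ((canonicalFiltration d).mono (min_le_right t s)) le_rfl

/-! ### The jump density and its adaptedness -/

/-- The conditional density at time `v` of the first jump, given the intrinsic path. -/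
noncomputable def jumpDensity {d : ℕ} (lam : State d → ℝ≥0) (ω : CadlagPath d) (v : ℝ≥0) : ℝ :=
  lam (ω v) * Real.exp (-∫ w in (0 : ℝ)..v, (lam (ω w.toNNReal) : ℝ))

theorem measurable_jumpDensity {d : ℕ} {lam : State d → ℝ≥0} (hlam : Measurable lam) :
    Measurable (fun p : CadlagPath d × ℝ≥0 => jumpDensity lam p.1 p.2) := by
  have h1 := hlam.comp (CadlagPath.measurable_eval_prod d)
  have h2 := CadlagPath.measurable_integral_eval hlam.coe_nnreal_real (d := d)
  exact h1.coe_nnreal_real.mul h2.neg.exp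

theorem jumpDensity_nonneg {d : ℕ} (lam : State d → ℝ≥0) (ω : CadlagPath d) (v : ℝ≥0) :
    0 ≤ jumpDensity lam ω v := by
  unfold jumpDensity; positivity

theorem jumpDensity_le {d : ℕ} {lam : State d → ℝ≥0} {C : ℝ≥0} (hC : ∀ z, lam z ≤ C)
    (ω : CadlagPath d) (v : ℝ≥0) : jumpDensity lam ω v ≤ C := by
  have h1 : 0 ≤ ∫ w in (0 : ℝ)..v, (lam (ω w.toNNReal) : ℝ) :=
    intervalIntegral.integral_nonneg v.coe_nonneg fun _ _ => NNReal.coe_nonneg _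
  calc jumpDensity lam ω v ≤ C * 1 := by
        unfold jumpDensity
        gcongr
        · exact_mod_cast hC _
        · simpa using h1
    _ = C := mul_one _

theorem jumpDensity_stopAt {d : ℕ} (lam : State d → ℝ≥0) (ω : CadlagPath d) (v : ℝ≥0) :
    jumpDensity lam (ω.stopAt v) v = jumpDensity lam ω v := by
  unfold jumpDensity
  congr 1
  · simp [CadlagPath.stopAt]
  · congr 2
    refine intervalIntegral.integral_congr fun w hw => ?_
    rw [uIcc_of_le v.coe_nonneg] at hw
    have : min w.toNNReal v = w.toNNReal := min_eq_left (Real.toNNReal_le_iff_le_coe.2 hw.2)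
    simp [CadlagPath.stopAt, this]

/-- Joint measurability does not give adaptedness. But stopping the path at `v` leaves the density
at `v` unchanged, and the stopping map is measurable for the σ-algebra at time `v`. -/
theorem stronglyMeasurable_jumpDensity_canonicalFiltration {d : ℕ} {lam : State d → ℝ≥0}
    (hlam : Measurable lam) (v : ℝ≥0) :
    StronglyMeasurable[canonicalFiltration d v] (fun ω => jumpDensity lam ω v) := by
  have h : (fun ω => jumpDensity lam ω v)
      = (fun ω : CadlagPath d => jumpDensity lam ω v) ∘ CadlagPath.stopAt v := by
    ext ω; exact (jumpDensity_stopAt lam ω v).symm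
  rw [h]
  exact (((measurable_jumpDensity hlam).comp (measurable_id.prodMk measurable_const)).comp
    (CadlagPath.measurable_stopAt v)).stronglyMeasurable

/-! ### Martingale increments and integration by parts along one path -/

/-- Conditioning on `ℱ v` pulls out the bounded factor `Z` and leaves an increment of conditional
mean zero. -/
theorem integral_mul_martingale_sub_eq_zero {S : Type*} {mS : MeasurableSpace S} {μ : Measure S}
    [IsFiniteMeasure μ] {ℱ : Filtration ℝ≥0 mS} {M : ℝ≥0 → S → ℝ} (hM : Martingale M ℱ μ)
    {v R : ℝ≥0} (hvR : v ≤ R) {Z : S → ℝ} (hZ : StronglyMeasurable[ℱ v] Z) {c : ℝ}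
    (hc : ∀ ω, |Z ω| ≤ c) : ∫ ω, Z ω * (M R ω - M v ω) ∂μ = 0 := by
  have hsub : Integrable (fun ω => M R ω - M v ω) μ := (hM.integrable R).sub (hM.integrable v)
  have h0 : μ[fun ω => M R ω - M v ω | ℱ v] =ᵐ[μ] 0 := by
    have h1 := condExp_sub (hM.integrable R) (hM.integrable v) (ℱ v)
    have h2 := hM.condExp_ae_eq hvR
    have h3 := hM.condExp_ae_eq (le_refl v)
    filter_upwards [h1, h2, h3] with ω h1 h2 h3
    have : (μ[fun ω => M R ω - M v ω | ℱ v]) ω = _ := h1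
    rw [this, Pi.sub_apply, h2, h3, sub_self]; rfl
  have h4 := condExp_stronglyMeasurable_mul_of_bound (ℱ.le v) hZ hsub c (ae_of_all _ hc)
  rw [← integral_condExp (ℱ.le v)]
  refine integral_eq_zero_of_ae ?_
  filter_upwards [h4, h0] with ω h4 h0
  have : (μ[fun ω => Z ω * (M R ω - M v ω) | ℱ v]) ω = _ := h4
  rw [this, Pi.mul_apply, h0]; simp

/-- Makes the survival function `exp(-∫ l)` Lipschitz, hence absolutely continuous, by composition;
the half-line suffices because `l ≥ 0`. -/
theorem lipschitzOnWith_exp_neg : LipschitzOnWith 1 (fun x : ℝ => Real.exp (-x)) (Ici 0) := by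
  refine (convex_Ici 0).lipschitzOnWith_of_nnnorm_hasDerivWithin_le
    (f' := fun x => Real.exp (-x) * -1)
    (fun x _ => ((hasDerivAt_neg x).exp).hasDerivWithinAt) fun x hx => ?_
  rw [← NNReal.coe_le_coe]
  simpa using hx

theorem lipschitzWith_integral_of_bounded {k : ℝ → ℝ} (hk : Measurable k) {C : ℝ≥0}
    (hC : ∀ v, |k v| ≤ C) : LipschitzWith C (fun v => ∫ w in (0 : ℝ)..v, k w) := by
  have hki := intervalIntegrable_of_bounded hk hC
  refine LipschitzWith.of_dist_le_mul fun a b => ?_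
  rw [Real.dist_eq, intervalIntegral.integral_interval_sub_left (hki _ _) (hki _ _), Real.dist_eq]
  exact intervalIntegral.norm_integral_le_of_norm_le_const (f := k) (C := C) fun v _ => hC v

/-- Integration by parts of `∫ᵥᴿ q` against `1 - exp(-∫₀ᵛ l)`: the first factor vanishes at `R` and
the second at `0`, so there are no boundary terms. As `l` and `q` are merely measurable, the
derivatives exist only almost everywhere and absolute continuity replaces smoothness. -/
theorem integral_density_mul_remaining {l q : ℝ → ℝ} (hl : Measurable l) (hq : Measurable q)
    (hl0 : ∀ v, 0 ≤ l v) {L K : ℝ} (hL : ∀ v, |l v| ≤ L) (hK : ∀ v, |q v| ≤ K) {R : ℝ}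
    (hR : 0 ≤ R) :
    ∫ v in (0 : ℝ)..R, (l v * Real.exp (-∫ w in (0 : ℝ)..v, l w)) *
        ((∫ w in (0 : ℝ)..R, q w) - ∫ w in (0 : ℝ)..v, q w)
      = ∫ v in (0 : ℝ)..R, q v * (1 - Real.exp (-∫ w in (0 : ℝ)..v, l w)) := by
  have hli := intervalIntegrable_of_bounded hl hL 0 R
  have hqi := intervalIntegrable_of_bounded hq hK 0 R
  have aJ : AbsolutelyContinuousOnInterval (fun v => ∫ w in (0 : ℝ)..v, q w) 0 R :=
    hqi.absolutelyContinuousOnInterval_intervalIntegral (by simp)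
  have aC : ∀ c : ℝ, AbsolutelyContinuousOnInterval (fun _ => c) 0 R := fun c =>
    (LipschitzWith.const' (K := 0) c).lipschitzOnWith.absolutelyContinuousOnInterval
  have aW : AbsolutelyContinuousOnInterval
      (fun v => 1 - Real.exp (-∫ w in (0 : ℝ)..v, l w)) 0 R := by
    have h1 : LipschitzWith L.toNNReal (fun v => ∫ w in (0 : ℝ)..v, l w) :=
      lipschitzWith_integral_of_bounded hl fun v => (hL v).trans (Real.le_coe_toNNReal L)
    have h2 := lipschitzOnWith_exp_neg.comp (h1.lipschitzOnWith (s := uIcc 0 R)) fun v hv => by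
      rw [uIcc_of_le hR] at hv
      exact intervalIntegral.integral_nonneg hv.1 fun w _ => hl0 w
    exact (aC 1).sub h2.absolutelyContinuousOnInterval
  have aU : AbsolutelyContinuousOnInterval
      (fun v => (∫ w in (0 : ℝ)..R, q w) - ∫ w in (0 : ℝ)..v, q w) 0 R := (aC _).sub aJ
  have key := AbsolutelyContinuousOnInterval.integral_mul_deriv_eq_deriv_mul aU aW
  have dL := hli.ae_hasDerivAt_integral
  have dJ := hqi.ae_hasDerivAt_integral
  have e1 : ∫ v in (0 : ℝ)..R, (l v * Real.exp (-∫ w in (0 : ℝ)..v, l w)) *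
        ((∫ w in (0 : ℝ)..R, q w) - ∫ w in (0 : ℝ)..v, q w)
      = ∫ v in (0 : ℝ)..R, ((∫ w in (0 : ℝ)..R, q w) - ∫ w in (0 : ℝ)..v, q w) *
        deriv (fun v => 1 - Real.exp (-∫ w in (0 : ℝ)..v, l w)) v := by
    refine intervalIntegral.integral_congr_ae ?_
    filter_upwards [dL] with v hv hv'
    have h := (((hv (uIoc_subset_uIcc hv') 0 (by simp)).fun_neg).exp.const_sub 1).deriv
    rw [h]; ring
  have e2 : ∫ v in (0 : ℝ)..R, deriv (fun v => (∫ w in (0 : ℝ)..R, q w) -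
        ∫ w in (0 : ℝ)..v, q w) v * (1 - Real.exp (-∫ w in (0 : ℝ)..v, l w))
      = -∫ v in (0 : ℝ)..R, q v * (1 - Real.exp (-∫ w in (0 : ℝ)..v, l w)) := by
    rw [← intervalIntegral.integral_neg]
    refine intervalIntegral.integral_congr_ae ?_
    filter_upwards [dJ] with v hv hv'
    have h := ((hv (uIoc_subset_uIcc hv') 0 (by simp)).const_sub (∫ w in (0 : ℝ)..R, q w)).deriv
    rw [h]; ring
  rw [e1, key, e2]
  simp

/-- Integration by parts along one path: `φ` is observed along the path, which is killed at rate
`l` and then replaced by a state where the mean value of the observable is `p`. -/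
theorem integral_excursion_identity {l φ h p : ℝ → ℝ} (hl : Measurable l) (hφ : Measurable φ)
    (hh : Measurable h) (hp : Measurable p) (hl0 : ∀ v, 0 ≤ l v) {L F H K : ℝ} (hL : ∀ v, |l v| ≤ L)
    (hF : ∀ v, |φ v| ≤ F) (hH : ∀ v, |h v| ≤ H) (hK : ∀ v, |p v| ≤ K)
    {R : ℝ} (hR : 0 ≤ R) :
    φ R - φ 0 - (∫ w in (0 : ℝ)..R, (h w + l w * (p w - φ w)))
      + ∫ v in (0 : ℝ)..R, (l v * Real.exp (-∫ w in (0 : ℝ)..v, l w)) *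
        (p v - φ R + ((∫ w in (0 : ℝ)..R, (h w + l w * (p w - φ w)))
          - ∫ w in (0 : ℝ)..v, (h w + l w * (p w - φ w))))
    = (φ R - φ 0 - ∫ w in (0 : ℝ)..R, h w)
      - ∫ v in (0 : ℝ)..R, (l v * Real.exp (-∫ w in (0 : ℝ)..v, l w)) *
        ((φ R - φ 0 - ∫ w in (0 : ℝ)..R, h w) - (φ v - φ 0 - ∫ w in (0 : ℝ)..v, h w)) := by
  set e : ℝ → ℝ := fun v => Real.exp (-∫ w in (0 : ℝ)..v, l w) with he
  set q : ℝ → ℝ := fun w => l w * (p w - φ w) with hq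
  have hqm : Measurable q := hl.mul (hp.sub hφ)
  have hqb : ∀ v, |q v| ≤ L * (K + F) := fun v => by
    rw [hq, abs_mul]
    have := abs_sub (p v) (φ v)
    exact mul_le_mul (hL v) (by linarith [hK v, hF v]) (abs_nonneg _) ((abs_nonneg _).trans (hL v))
  have hli := intervalIntegrable_of_bounded hl hL
  have hhi := intervalIntegrable_of_bounded hh hH
  have hqi := intervalIntegrable_of_bounded hqm hqb
  have hsplit : ∀ v, ∫ w in (0 : ℝ)..v, (h w + q w)
      = (∫ w in (0 : ℝ)..v, h w) + ∫ w in (0 : ℝ)..v, q w := fun v =>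
    intervalIntegral.integral_add (hhi 0 v) (hqi 0 v)
  have cont : ∀ k : ℝ → ℝ, (∀ a b, IntervalIntegrable k volume a b) →
      Continuous fun v => ∫ w in (0 : ℝ)..v, k w := fun k hk =>
    intervalIntegral.continuous_primitive hk 0
  have ce : Continuous e := (cont l hli).neg.rexp
  have key := integral_density_mul_remaining hl hqm hl0 hL hqb hR
  -- `φ` need not be continuous, so its term is split off and `φ` is paired with `l` as a bounded
  -- measurable factor; what remains is continuous.
  have i1 : IntervalIntegrable (fun v => l v * e v *
      ((φ R - φ 0 - ∫ w in (0 : ℝ)..R, h w) - (φ v - φ 0 - ∫ w in (0 : ℝ)..v, h w)))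
      volume 0 R := by
    have hlφ : ∀ v, |l v * φ v| ≤ L * F := fun v => by
      rw [abs_mul]
      exact mul_le_mul (hL v) (hF v) (abs_nonneg _) ((abs_nonneg _).trans (hL v))
    have j1 : IntervalIntegrable (fun v => l v * (e v *
        (φ R - (∫ w in (0 : ℝ)..R, h w) + ∫ w in (0 : ℝ)..v, h w))) volume 0 R :=
      (hli 0 R).mul_continuousOn (ce.mul (continuous_const.add (cont h hhi))).continuousOn
    have j2 : IntervalIntegrable (fun v => l v * φ v * e v) volume 0 R :=
      (intervalIntegrable_of_bounded (hl.mul hφ) hlφ 0 R).mul_continuousOn ce.continuousOn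
    convert j1.sub j2 using 2 with v
    ring
  have i2 : IntervalIntegrable (fun v => l v * e v *
      ((∫ w in (0 : ℝ)..R, q w) - ∫ w in (0 : ℝ)..v, q w)) volume 0 R :=
    ((hli 0 R).mul_continuousOn ce.continuousOn).mul_continuousOn
      (continuous_const.sub (cont q hqi)).continuousOn
  have i3 : IntervalIntegrable (fun v => q v * e v) volume 0 R :=
    (hqi 0 R).mul_continuousOn ce.continuousOn
  -- Adding and subtracting `φ v` turns `p v - φ R` into `(p v - φ v) - (φ R - φ v)`: the first part
  -- gives `q v * e v`, the second joins the `h` integrals to form the martingale increment. By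
  -- `key`, the two `q` integrals then add up to `∫ q`.
  have e1 : ∫ v in (0 : ℝ)..R, (l v * e v) *
        (p v - φ R + ((∫ w in (0 : ℝ)..R, (h w + q w)) - ∫ w in (0 : ℝ)..v, (h w + q w)))
      = (∫ v in (0 : ℝ)..R, q v * e v) + (∫ v in (0 : ℝ)..R, l v * e v *
      ((∫ w in (0 : ℝ)..R, q w) - ∫ w in (0 : ℝ)..v, q w)) - ∫ v in (0 : ℝ)..R, l v * e v *
      ((φ R - φ 0 - ∫ w in (0 : ℝ)..R, h w) - (φ v - φ 0 - ∫ w in (0 : ℝ)..v, h w)) := by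
    rw [← intervalIntegral.integral_add i3 i2, ← intervalIntegral.integral_sub (i3.add i2) i1]
    refine intervalIntegral.integral_congr fun v _ => ?_
    simp only [hsplit]
    rw [show q v = l v * (p v - φ v) from rfl]
    ring
  have e2 : ∫ v in (0 : ℝ)..R, q v * (1 - e v)
      = (∫ v in (0 : ℝ)..R, q v) - ∫ v in (0 : ℝ)..R, q v * e v := by
    rw [← intervalIntegral.integral_sub (hqi 0 R) i3]
    simp only [mul_sub, mul_one]
  rw [e1, key, e2, hsplit]
  ring

/-! ### Mean of one excursion for a fixed starting law -/

theorem measurable_dynkinProcess {d : ℕ} {f h : State d → ℝ} (hf : Measurable f)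
    (hh : Measurable h) :
    Measurable (fun p : CadlagPath d × ℝ≥0 => dynkinProcess f h p.2 p.1) :=
  ((hf.comp (CadlagPath.measurable_eval_prod d)).sub
    (hf.comp ((CadlagPath.measurable_eval 0).comp measurable_fst))).sub
    (CadlagPath.measurable_integral_eval hh)

theorem abs_integral_eval_le {d : ℕ} {h : State d → ℝ} {H : ℝ} (hH : ∀ z, |h z| ≤ H)
    (ω : CadlagPath d) {a b : ℝ} :
    |∫ v in a..b, h (ω v.toNNReal)| ≤ H * |b - a| :=
  intervalIntegral.norm_integral_le_of_norm_le_const (f := fun v => h (ω v.toNNReal))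
    fun _ _ => hH _

theorem abs_dynkinProcess_le {d : ℕ} {f h : State d → ℝ} {F H : ℝ} (hF : ∀ z, |f z| ≤ F)
    (hH : ∀ z, |h z| ≤ H) (t : ℝ≥0) (ω : CadlagPath d) :
    |(dynkinProcess f h t ω)| ≤ 2 * F + H * t := by
  have h1 := abs_integral_eval_le hH ω (a := 0) (b := t)
  rw [sub_zero, abs_of_nonneg t.coe_nonneg] at h1
  have h2 := hF (ω t)
  have h3 := hF (ω 0)
  unfold dynkinProcess
  rw [abs_le] at *
  constructor <;> linarith

/-- The martingale property gives a vanishing mean for the killed Dynkin process. -/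
theorem integral_dynkinProcess_sub_integral_jumpDensity {d : ℕ} (μ : Measure (CadlagPath d))
    [IsProbabilityMeasure μ] {lam : State d → ℝ≥0} (hlam : Measurable lam) {C : ℝ≥0}
    (hC : ∀ z, lam z ≤ C) {f h : State d → ℝ} (hf : Measurable f) (hh : Measurable h) {F H : ℝ}
    (hF : ∀ z, |f z| ≤ F) (hH : ∀ z, |h z| ≤ H)
    (hM : Martingale (dynkinProcess f h) (canonicalFiltration d) μ) (R : ℝ≥0) :
    ∫ ω, (dynkinProcess f h R ω - ∫ v in (0 : ℝ)..R, jumpDensity lam ω v.toNNReal *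
      (dynkinProcess f h R ω - dynkinProcess f h v.toNNReal ω)) ∂μ = 0 := by
  have hH0 : 0 ≤ H := (abs_nonneg _).trans (hH 0)
  have hF0 : 0 ≤ F := (abs_nonneg _).trans (hF 0)
  have hmeas : Measurable (fun q : CadlagPath d × ℝ => jumpDensity lam q.1 q.2.toNNReal *
      (dynkinProcess f h R q.1 - dynkinProcess f h q.2.toNNReal q.1)) := by
    have hm : Measurable (fun q : CadlagPath d × ℝ => (q.1, q.2.toNNReal)) :=
      measurable_fst.prodMk (measurable_real_toNNReal.comp measurable_snd)
    exact ((measurable_jumpDensity hlam).comp hm).mul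
      (((measurable_dynkinProcess hf hh).comp (measurable_fst.prodMk measurable_const)).sub
        ((measurable_dynkinProcess hf hh).comp hm))
  have hint : Integrable (fun q : CadlagPath d × ℝ => jumpDensity lam q.1 q.2.toNNReal *
      (dynkinProcess f h R q.1 - dynkinProcess f h q.2.toNNReal q.1))
      (μ.prod (volume.restrict (Ioc (0 : ℝ) R))) := by
    refine Integrable.mono' (integrable_const (C * (2 * (2 * F + H * R))))
      hmeas.aestronglyMeasurable ?_
    have hmem : ∀ᵐ q : CadlagPath d × ℝ ∂μ.prod (volume.restrict (Ioc (0 : ℝ) R)),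
        q.2 ∈ Ioc (0 : ℝ) R :=
      Measure.quasiMeasurePreserving_snd.ae (ae_restrict_mem measurableSet_Ioc)
    filter_upwards [hmem] with q hq
    rw [Real.norm_eq_abs, abs_mul, abs_of_nonneg (jumpDensity_nonneg _ _ _)]
    have h1 := abs_dynkinProcess_le hF hH R q.1
    have h2 := abs_dynkinProcess_le hF hH q.2.toNNReal q.1
    have h3 : H * (q.2.toNNReal : ℝ) ≤ H * R := by
      rw [Real.coe_toNNReal _ hq.1.le]
      exact mul_le_mul_of_nonneg_left hq.2 hH0
    have h4 := abs_sub (dynkinProcess f h R q.1) (dynkinProcess f h q.2.toNNReal q.1)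
    exact mul_le_mul (jumpDensity_le hC _ _) (by linarith) (abs_nonneg _) C.coe_nonneg
  -- The case `Z = 1`, `v = 0` of orthogonality, since the Dynkin process vanishes at time `0`.
  have h0 : ∫ ω, dynkinProcess f h R ω ∂μ = 0 := by
    have h1 := integral_mul_martingale_sub_eq_zero hM (zero_le (a := R))
      (stronglyMeasurable_const (b := (1 : ℝ))) (c := 1) (by simp)
    simpa [dynkinProcess] using h1
  simp only [intervalIntegral.integral_of_le R.coe_nonneg]
  -- Fubini puts the mean over paths inside, so that orthogonality is used at each fixed `v`.
  rw [integral_sub (hM.integrable R) hint.integral_prod_left, h0,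
    integral_integral_swap hint, zero_sub, neg_eq_zero]
  refine setIntegral_eq_zero_of_forall_eq_zero fun v hv => ?_
  exact integral_mul_martingale_sub_eq_zero hM (Real.toNNReal_le_iff_le_coe.2 hv.2)
    (stronglyMeasurable_jumpDensity_canonicalFiltration hlam _) (c := C) fun ω => by
      rw [abs_of_nonneg (jumpDensity_nonneg _ _ _)]; exact jumpDensity_le hC _ _

theorem measurable_switchedGenerator {d : ℕ} {lam : State d → ℝ≥0} (hlam : Measurable lam)
    (Q : Kernel (State d) (State d)) [IsMarkovKernel Q] {f h : State d → ℝ} (hf : Measurable f)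
    (hh : Measurable h) : Measurable (switchedGenerator lam Q f h) := by
  refine hh.add (hlam.coe_nnreal_real.mul ?_)
  have h1 : StronglyMeasurable (fun p : State d × State d => f p.2 - f p.1) :=
    ((hf.comp measurable_snd).sub (hf.comp measurable_fst)).stronglyMeasurable
  exact (h1.integral_kernel_prod_right' (κ := Q)).measurable

theorem integrable_of_abs_le {S : Type*} [MeasurableSpace S] {f : S → ℝ} (hf : Measurable f)
    {F : ℝ} (hF : ∀ z, |f z| ≤ F) (μ : Measure S) [IsFiniteMeasure μ] : Integrable f μ :=
  Integrable.mono' (integrable_const F) hf.aestronglyMeasurable (ae_of_all _ hF)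

theorem switchedGenerator_eq {d : ℕ} (lam : State d → ℝ≥0)
    (Q : Kernel (State d) (State d)) [IsMarkovKernel Q] {f : State d → ℝ} (h : State d → ℝ)
    (hf : Measurable f) {F : ℝ} (hF : ∀ z, |f z| ≤ F) (z : State d) :
    switchedGenerator lam Q f h z = h z + lam z * ((∫ y, f y ∂Q z) - f z) := by
  unfold switchedGenerator
  rw [integral_sub (integrable_of_abs_le hf hF _) (integrable_const _)]
  simp

theorem abs_integral_kernel_le {d : ℕ} (Q : Kernel (State d) (State d)) [IsMarkovKernel Q]
    {f : State d → ℝ} {F : ℝ} (hF : ∀ z, |f z| ≤ F) (z : State d) :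
    |∫ y, f y ∂Q z| ≤ F := by
  simpa using norm_integral_le_of_norm_le_const (μ := Q z) (f := f) (ae_of_all _ hF)

theorem abs_switchedGenerator_le {d : ℕ} {lam : State d → ℝ≥0} {C : ℝ≥0}
    (hC : ∀ z, lam z ≤ C) (Q : Kernel (State d) (State d)) [IsMarkovKernel Q]
    {f h : State d → ℝ} (hf : Measurable f) {F H : ℝ}
    (hF : ∀ z, |f z| ≤ F) (hH : ∀ z, |h z| ≤ H) (z : State d) :
    |switchedGenerator lam Q f h z| ≤ H + C * (2 * F) := by
  rw [switchedGenerator_eq lam Q h hf hF]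
  have h1 := abs_integral_kernel_le Q hF z
  have h2 := abs_sub (∫ y, f y ∂Q z) (f z)
  have h3 : |(lam z : ℝ) * ((∫ y, f y ∂Q z) - f z)| ≤ C * (2 * F) := by
    rw [abs_mul, NNReal.abs_eq]
    exact mul_le_mul (by exact_mod_cast hC z) (by linarith [hF z]) (abs_nonneg _) C.coe_nonneg
  exact (abs_add_le _ _).trans (add_le_add (hH z) h3)

/-- Up to time `R`, the mean gain of `f` minus its compensator over one excursion is zero. -/
theorem integral_excursion_eq_zero {d : ℕ} (μ : Measure (CadlagPath d))
    [IsProbabilityMeasure μ] {lam : State d → ℝ≥0} (hlam : Measurable lam) {C : ℝ≥0}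
    (hC : ∀ z, lam z ≤ C) (Q : Kernel (State d) (State d)) [IsMarkovKernel Q]
    {f h : State d → ℝ} (hf : Measurable f) (hh : Measurable h) {F H : ℝ}
    (hF : ∀ z, |f z| ≤ F) (hH : ∀ z, |h z| ≤ H)
    (hM : Martingale (dynkinProcess f h) (canonicalFiltration d) μ) (R : ℝ≥0) :
    ∫ ω, (dynkinProcess f (switchedGenerator lam Q f h) R ω
      + ∫ v in (0 : ℝ)..R, jumpDensity lam ω v.toNNReal *
        ((∫ y, f y ∂Q (ω v.toNNReal)) + (-f (ω R)
          + ((∫ w in (0 : ℝ)..R, switchedGenerator lam Q f h (ω w.toNNReal))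
            - ∫ w in (0 : ℝ)..v.toNNReal, switchedGenerator lam Q f h (ω w.toNNReal))))) ∂μ
      = 0 := by
  refine Eq.trans (integral_congr_ae (ae_of_all _ fun ω => ?_))
    (integral_dynkinProcess_sub_integral_jumpDensity μ hlam hC hf hh hF hH hM R)
  have hω := ω.measurable_realTime
  have hQf : Measurable fun z => ∫ y, f y ∂Q z := hf.stronglyMeasurable.integral_kernel.measurable
  have key := integral_excursion_identity (hlam.coe_nnreal_real.comp hω) (hf.comp hω)
    (hh.comp hω) (hQf.comp hω) (fun v => NNReal.coe_nonneg _)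
    (L := C) (fun v => by simpa using hC _) (fun v => hF _) (fun v => hH _)
    (fun v => abs_integral_kernel_le Q hF _) R.coe_nonneg
  simp only [Function.comp_apply, Real.toNNReal_coe, Real.toNNReal_zero,
    ← switchedGenerator_eq lam Q h hf hF] at key
  convert key using 2
  · rfl
  · refine intervalIntegral.integral_congr fun v hv => ?_
    rw [uIcc_of_le R.coe_nonneg] at hv
    simp only [jumpDensity, Real.coe_toNNReal _ hv.1]
    ring
  · rfl
  · refine intervalIntegral.integral_congr fun v hv => ?_
    rw [uIcc_of_le R.coe_nonneg] at hv
    simp only [jumpDensity, dynkinProcess, Real.coe_toNNReal _ hv.1]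

/-! ### Integrals against the jump kernels -/

theorem measurable_hazardDensity {d : ℕ} {lam : State d → ℝ≥0} (hlam : Measurable lam) :
    Measurable (Function.uncurry fun (ω : CadlagPath d) (v : ℝ≥0) => (lam (ω v) *
        (Real.exp (-∫ w in (0 : ℝ)..v, (lam (ω w.toNNReal) : ℝ))).toNNReal : ℝ≥0)) := by
  have h1 := hlam.comp (CadlagPath.measurable_eval_prod d)
  have h2 := CadlagPath.measurable_integral_eval hlam.coe_nnreal_real (d := d)
  exact h1.mul h2.neg.exp.real_toNNReal

theorem coe_hazardDensity {d : ℕ} (lam : State d → ℝ≥0) (ω : CadlagPath d) (v : ℝ≥0) :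
    ((lam (ω v) * (Real.exp (-∫ w in (0 : ℝ)..v, (lam (ω w.toNNReal) : ℝ))).toNNReal : ℝ≥0) : ℝ)
      = jumpDensity lam ω v := by
  rw [NNReal.coe_mul, Real.coe_toNNReal _ (Real.exp_pos _).le, jumpDensity]

instance {d : ℕ} (lam : State d → ℝ≥0) : IsSFiniteKernel (hazardKernel (d := d) lam) := by
  unfold hazardKernel; infer_instance

instance {d : ℕ} (lam : State d → ℝ≥0) (Q : Kernel (State d) (State d)) [IsMarkovKernel Q] :
    IsSFiniteKernel (switchKernel lam Q) := by
  unfold switchKernel; infer_instance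

theorem lintegral_hazardKernel {d : ℕ} {lam : State d → ℝ≥0} (hlam : Measurable lam)
    (ω : CadlagPath d) {g : ℝ≥0 → ℝ≥0∞} (hg : Measurable g) :
    ∫⁻ v, g v ∂hazardKernel lam ω
      = ∫⁻ v in Ici (0 : ℝ), ENNReal.ofReal (jumpDensity lam ω v.toNNReal) * g v.toNNReal := by
  have hd := measurable_hazardDensity hlam
  rw [hazardKernel, Kernel.lintegral_withDensity _ hd.coe_nnreal_ennreal _ hg, Kernel.const_apply,
    lebesgueTime, lintegral_map _ measurable_real_toNNReal]
  · refine lintegral_congr fun v => ?_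
    rw [← coe_hazardDensity, ENNReal.ofReal_coe_nnreal]
  · exact (hd.comp (measurable_const.prodMk measurable_id)).coe_nnreal_ennreal.mul hg

theorem integral_hazardKernel {d : ℕ} {lam : State d → ℝ≥0} (hlam : Measurable lam)
    (ω : CadlagPath d) {g : ℝ≥0 → ℝ} (hg : Measurable g) :
    ∫ v, g v ∂hazardKernel lam ω
      = ∫ v in Ici (0 : ℝ), jumpDensity lam ω v.toNNReal * g v.toNNReal := by
  have hd := measurable_hazardDensity hlam
  rw [hazardKernel, Kernel.integral_withDensity hd, Kernel.const_apply,
    lebesgueTime, integral_map measurable_real_toNNReal.aemeasurable]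
  · refine integral_congr_ae (ae_of_all _ fun v => ?_)
    simp only [NNReal.smul_def, smul_eq_mul, coe_hazardDensity]
  · exact (((hd.comp (measurable_const.prodMk measurable_id)).smul hg)).aestronglyMeasurable

theorem lintegral_switchKernel_snd {d : ℕ} {lam : State d → ℝ≥0} (hlam : Measurable lam)
    (Q : Kernel (State d) (State d)) [IsMarkovKernel Q] (ω : CadlagPath d) {g : ℝ≥0 → ℝ≥0∞}
    (hg : Measurable g) :
    ∫⁻ z, g z.2 ∂switchKernel lam Q ω
      = ∫⁻ v in Ici (0 : ℝ), ENNReal.ofReal (jumpDensity lam ω v.toNNReal) * g v.toNNReal := by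
  rw [switchKernel, Kernel.lintegral_map _ measurable_swap _
    (g' := fun z : State d × ℝ≥0 => g z.2) (hg.comp measurable_snd),
    Kernel.lintegral_compProd _ _ _ (by fun_prop), ← lintegral_hazardKernel hlam ω hg]
  simp

theorem integral_switchKernel {d : ℕ} {lam : State d → ℝ≥0} (hlam : Measurable lam)
    (Q : Kernel (State d) (State d)) [IsMarkovKernel Q] (ω : CadlagPath d)
    {g : State d × ℝ≥0 → ℝ} (hg : Measurable g) (hgi : Integrable g (switchKernel lam Q ω)) :
    ∫ z, g z ∂switchKernel lam Q ω
      = ∫ v in Ici (0 : ℝ), jumpDensity lam ω v.toNNReal *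
        ∫ y, g (y, v.toNNReal) ∂Q (ω v.toNNReal) := by
  rw [switchKernel, Kernel.map_apply _ measurable_swap] at hgi ⊢
  rw [integral_map measurable_swap.aemeasurable hg.aestronglyMeasurable,
    ProbabilityTheory.integral_compProd]
  · simp only [Kernel.comap_apply, Prod.swap_prod_mk]
    rw [integral_hazardKernel hlam ω]
    have h1 : StronglyMeasurable (fun p : ℝ≥0 × State d => g (p.2, p.1)) :=
      (hg.comp measurable_swap).stronglyMeasurable
    have h2 : Measurable (fun v : ℝ≥0 => ω v) :=
      (CadlagPath.measurable_eval_prod d).comp (measurable_const.prodMk measurable_id)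
    exact (h1.integral_kernel_prod_right' (κ := Q.comap _ h2)).measurable
  · exact (integrable_map_measure hg.aestronglyMeasurable measurable_swap.aemeasurable).1 hgi

/-- The cutoff confines the time integral to `[0, R]`, and `a` passes through the average over the
new state because `Q` is Markov. This is the shape of `excursionGain` for a fixed path. -/
theorem integral_switchKernel_of_support {d : ℕ} {lam : State d → ℝ≥0} (hlam : Measurable lam)
    (Q : Kernel (State d) (State d)) [IsMarkovKernel Q] (ω : CadlagPath d) {f : State d → ℝ}
    (hf : Measurable f) {F : ℝ} (hF : ∀ z, |f z| ≤ F) {a : ℝ≥0 → ℝ} (ha : Measurable a) (R : ℝ≥0)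
    (hi : Integrable (fun z : State d × ℝ≥0 => if z.2 ≤ R then f z.1 + a z.2 else 0)
      (switchKernel lam Q ω)) :
    ∫ z, (if z.2 ≤ R then f z.1 + a z.2 else 0) ∂switchKernel lam Q ω
      = ∫ v in (0 : ℝ)..R, jumpDensity lam ω v.toNNReal *
        ((∫ y, f y ∂Q (ω v.toNNReal)) + a v.toNNReal) := by
  have hm : Measurable (fun z : State d × ℝ≥0 => if z.2 ≤ R then f z.1 + a z.2 else 0) :=
    Measurable.ite (measurableSet_le measurable_snd measurable_const)
      ((hf.comp measurable_fst).add (ha.comp measurable_snd)) measurable_const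
  rw [integral_switchKernel hlam Q ω hm hi, intervalIntegral.integral_of_le R.coe_nonneg,
    ← integral_Icc_eq_integral_Ioc, ← integral_indicator measurableSet_Ici,
    ← integral_indicator measurableSet_Icc]
  refine integral_congr_ae (ae_of_all _ fun v => ?_)
  by_cases h0 : 0 ≤ v
  · by_cases hR : v ≤ R
    · have hR' : v.toNNReal ≤ R := Real.toNNReal_le_iff_le_coe.2 hR
      rw [indicator_of_mem (mem_Ici.2 h0), indicator_of_mem (mem_Icc.2 ⟨h0, hR⟩)]
      simp only [hR', if_true]
      rw [integral_add (integrable_of_abs_le hf hF _) (integrable_const _)]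
      simp
    · have hR' : ¬ v.toNNReal ≤ R := fun h => hR (Real.toNNReal_le_iff_le_coe.1 h)
      rw [indicator_of_mem (mem_Ici.2 h0), indicator_of_notMem (fun h => hR h.2)]
      simp [hR']
  · rw [indicator_of_notMem (fun h => h0 (mem_Ici.1 h)), indicator_of_notMem (fun h => h0 h.1)]

/-! ### Excursions under the conditional laws -/

/-- The gain of `f` minus the integral of `g`, up to time `R`, along a path `ω` which jumps to `y`
at time `v`. -/
noncomputable def excursionGain {d : ℕ} (f g : State d → ℝ) (R : ℝ≥0) (ω : CadlagPath d)
    (z : State d × ℝ≥0) : ℝ :=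
  if z.2 ≤ R then f z.1 + (-f (ω R) + ((∫ w in (0 : ℝ)..R, g (ω w.toNNReal))
    - ∫ w in (0 : ℝ)..z.2, g (ω w.toNNReal))) else 0

theorem measurable_excursionGain {d : ℕ} {f g : State d → ℝ} (hf : Measurable f)
    (hg : Measurable g) : Measurable (fun p : (ℝ≥0 × CadlagPath d) × (State d × ℝ≥0) =>
      excursionGain f g p.1.1 p.1.2 p.2) := by
  have h1 : Measurable (fun p : (ℝ≥0 × CadlagPath d) × (State d × ℝ≥0) => p.1.2 p.1.1) :=
    (CadlagPath.measurable_eval_prod d).comp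
      (f := fun p : (ℝ≥0 × CadlagPath d) × (State d × ℝ≥0) => (p.1.2, p.1.1)) (by fun_prop)
  have h2 : Measurable (fun p : (ℝ≥0 × CadlagPath d) × (State d × ℝ≥0) =>
      ∫ w in (0 : ℝ)..p.1.1, g (p.1.2 w.toNNReal)) :=
    (CadlagPath.measurable_integral_eval hg).comp
      (f := fun p : (ℝ≥0 × CadlagPath d) × (State d × ℝ≥0) => (p.1.2, p.1.1)) (by fun_prop)
  have h3 : Measurable (fun p : (ℝ≥0 × CadlagPath d) × (State d × ℝ≥0) =>
      ∫ w in (0 : ℝ)..p.2.2, g (p.1.2 w.toNNReal)) :=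
    (CadlagPath.measurable_integral_eval hg).comp
      (f := fun p : (ℝ≥0 × CadlagPath d) × (State d × ℝ≥0) => (p.1.2, p.2.2)) (by fun_prop)
  exact Measurable.ite (measurableSet_le (by fun_prop) (by fun_prop))
    ((by fun_prop : Measurable fun p : (ℝ≥0 × CadlagPath d) × (State d × ℝ≥0) => f p.2.1).add
      ((hf.comp h1).neg.add (h2.sub h3))) measurable_const

theorem abs_excursionGain_le {d : ℕ} {f g : State d → ℝ} (hg : Measurable g) {F G : ℝ}
    (hF : ∀ z, |f z| ≤ F) (hG : ∀ z, |g z| ≤ G) (R : ℝ≥0) (ω : CadlagPath d)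
    (z : State d × ℝ≥0) : |excursionGain f g R ω z| ≤ 2 * F + G * R := by
  have hF0 : 0 ≤ F := (abs_nonneg _).trans (hF 0)
  have hG0 : 0 ≤ G := (abs_nonneg _).trans (hG 0)
  unfold excursionGain
  split_ifs with hz
  · have hi := intervalIntegrable_of_bounded (hg.comp ω.measurable_realTime) fun v => hG _
    have h1 := abs_integral_eval_le hG ω (a := z.2) (b := R)
    have h4 := intervalIntegral.integral_interval_sub_left (hi 0 R) (hi 0 z.2)
    simp only [Function.comp_apply] at h4
    rw [← h4, abs_of_nonneg (sub_nonneg.2 (NNReal.coe_le_coe.2 hz))] at h1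
    have h2 := hF z.1
    have h3 := hF (ω R)
    have h5 : G * ((R : ℝ) - z.2) ≤ G * R :=
      mul_le_mul_of_nonneg_left (by linarith [z.2.coe_nonneg]) hG0
    rw [abs_le] at *
    constructor <;> linarith
  · rw [abs_zero]; positivity

theorem measurable_dynkinProcess_comp {d : ℕ} {f g : State d → ℝ} (hf : Measurable f)
    (hg : Measurable g) {E : Type*} [MeasurableSpace E] {R : E → ℝ≥0} (hR : Measurable R)
    {φ : E → CadlagPath d} (hφ : Measurable φ) :
    Measurable fun e => dynkinProcess f g (R e) (φ e) :=
  (measurable_dynkinProcess hf hg).comp (hφ.prodMk hR)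

/-- Two disintegrations: the jump pair given past and path, then the path given the past. The
horizon `t - τ` is a function of the past, hence deterministic at the inner level, where
`integral_excursion_eq_zero` applies to the law started from `x`. -/
theorem integrable_and_integral_excursion {Ω 𝓗 : Type*} [MeasurableSpace Ω] [MeasurableSpace 𝓗]
    {Pr : Measure Ω} [IsProbabilityMeasure Pr] {d : ℕ} {P : Kernel (State d) (CadlagPath d)}
    [IsMarkovKernel P] {lam : State d → ℝ≥0} (hlam : Measurable lam) {C : ℝ≥0}
    (hC : ∀ z, lam z ≤ C) (Q : Kernel (State d) (State d)) [IsMarkovKernel Q]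
    {f h : State d → ℝ} (hf : Measurable f) (hh : Measurable h) {F H : ℝ}
    (hF : ∀ z, |f z| ≤ F) (hH : ∀ z, |h z| ≤ H)
    (hM : ∀ x, Martingale (dynkinProcess f h) (canonicalFiltration d) (P x))
    {past : Ω → 𝓗} {x : 𝓗 → State d} (hx : Measurable x) {τ : 𝓗 → ℝ≥0} (hτ : Measurable τ)
    {ζ : Ω → CadlagPath d} {Z : Ω → State d × ℝ≥0}
    (h1 : HasCondDistrib ζ past (P.comap x hx) Pr)
    (h2 : HasCondDistrib Z (fun ω => (past ω, ζ ω))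
      ((switchKernel lam Q).comap (fun q : 𝓗 × CadlagPath d => q.2)
        (measurable_snd : Measurable fun q : 𝓗 × CadlagPath d => q.2)) Pr)
    (t : ℝ≥0) :
    Integrable (fun ω => if τ (past ω) ≤ t then
      dynkinProcess f (switchedGenerator lam Q f h) (t - τ (past ω)) (ζ ω)
        + excursionGain f (switchedGenerator lam Q f h) (t - τ (past ω)) (ζ ω) (Z ω) else 0) Pr ∧
    ∫ ω, (if τ (past ω) ≤ t then
      dynkinProcess f (switchedGenerator lam Q f h) (t - τ (past ω)) (ζ ω)
        + excursionGain f (switchedGenerator lam Q f h) (t - τ (past ω)) (ζ ω) (Z ω) else 0) ∂Pr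
      = 0 := by
  set g := switchedGenerator lam Q f h
  have hgm : Measurable g := measurable_switchedGenerator hlam Q hf hh
  set G := H + C * (2 * F)
  have hG : ∀ z, |g z| ≤ G := abs_switchedGenerator_le hC Q hf hF hH
  have hF0 : 0 ≤ F := (abs_nonneg _).trans (hF 0)
  have hG0 : 0 ≤ G := (abs_nonneg _).trans (hG 0)
  have hst : ∀ s : ℝ≥0, 2 * F + G * ((t - s : ℝ≥0) : ℝ) ≤ 2 * F + G * t := fun s => by
    have : ((t - s : ℝ≥0) : ℝ) ≤ t := NNReal.coe_le_coe.2 tsub_le_self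
    gcongr
  have m1 : AEMeasurable (fun ω => (past ω, ζ ω)) Pr := h2.aemeasurable_fst
  have m2 : AEMeasurable (fun ω => ((past ω, ζ ω), Z ω)) Pr := HasLaw.aemeasurable h2
  have := Measure.isProbabilityMeasure_map h1.aemeasurable_fst
  have := Measure.isProbabilityMeasure_map m1
  have := Measure.isProbabilityMeasure_map m2
  have law1 := HasLaw.map_eq h1
  have law2 := HasLaw.map_eq h2
  let G1 : 𝓗 × CadlagPath d → ℝ := fun q =>
    if τ q.1 ≤ t then dynkinProcess f g (t - τ q.1) q.2 else 0
  let G2 : (𝓗 × CadlagPath d) × (State d × ℝ≥0) → ℝ := fun q =>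
    if τ q.1.1 ≤ t then excursionGain f g (t - τ q.1.1) q.1.2 q.2 else 0
  have G1m : Measurable G1 := Measurable.ite
    (measurableSet_le (hτ.comp measurable_fst) measurable_const)
    (measurable_dynkinProcess_comp hf hgm (by fun_prop) measurable_snd) measurable_const
  have G2m : Measurable G2 := Measurable.ite
    (measurableSet_le (hτ.comp measurable_fst.fst) measurable_const)
    ((measurable_excursionGain hf hgm).comp
      (f := fun q : (𝓗 × CadlagPath d) × (State d × ℝ≥0) => ((t - τ q.1.1, q.1.2), q.2))
      (by fun_prop)) measurable_const
  have hK : 0 ≤ 2 * F + G * t := by positivity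
  have G1b : ∀ q, |G1 q| ≤ 2 * F + G * t := fun q => by
    simp only [G1]
    split_ifs
    · exact (abs_dynkinProcess_le hF hG _ _).trans (hst _)
    · simpa using hK
  have G2b : ∀ q, |G2 q| ≤ 2 * F + G * t := fun q => by
    simp only [G2]
    split_ifs
    · exact (abs_excursionGain_le hgm hF hG _ _ _).trans (hst _)
    · simpa using hK
  have i1 := integrable_of_abs_le G1m G1b (Pr.map fun ω => (past ω, ζ ω))
  have i2 := integrable_of_abs_le G2m G2b (Pr.map fun ω => ((past ω, ζ ω), Z ω))
  have i1' : Integrable (fun ω => G1 (past ω, ζ ω)) Pr := i1.comp_aemeasurable m1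
  have i2' : Integrable (fun ω => G2 ((past ω, ζ ω), Z ω)) Pr := i2.comp_aemeasurable m2
  have hsplit : (fun ω => if τ (past ω) ≤ t then
      dynkinProcess f g (t - τ (past ω)) (ζ ω) + excursionGain f g (t - τ (past ω)) (ζ ω) (Z ω)
        else 0) = fun ω => G1 (past ω, ζ ω) + G2 ((past ω, ζ ω), Z ω) := by
    ext ω
    simp only [G1, G2]
    split_ifs <;> simp
  rw [hsplit]
  refine ⟨i1'.add i2', ?_⟩
  rw [integral_add i1' i2', ← integral_map m1 G1m.aestronglyMeasurable,
    ← integral_map m2 G2m.aestronglyMeasurable, law2]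
  rw [law2] at i2
  have i3 : Integrable (fun q => ∫ z, G2 (q, z) ∂switchKernel lam Q q.2)
      (Pr.map fun ω => (past ω, ζ ω)) :=
    i2.integral_compProd
  rw [Measure.integral_compProd i2]
  simp only [Kernel.comap_apply]
  rw [← integral_add i1 i3]
  let Φ : 𝓗 × CadlagPath d → ℝ := fun q => if τ q.1 ≤ t then
    dynkinProcess f g (t - τ q.1) q.2
      + ∫ v in (0 : ℝ)..(t - τ q.1 : ℝ≥0), jumpDensity lam q.2 v.toNNReal *
        ((∫ y, f y ∂Q (q.2 v.toNNReal)) + (-f (q.2 (t - τ q.1))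
          + ((∫ w in (0 : ℝ)..(t - τ q.1 : ℝ≥0), g (q.2 w.toNNReal))
            - ∫ w in (0 : ℝ)..v.toNNReal, g (q.2 w.toNNReal)))) else 0
  have hΦ : (fun q => G1 q + ∫ z, G2 (q, z) ∂switchKernel lam Q q.2)
      =ᵐ[Pr.map fun ω => (past ω, ζ ω)] Φ := by
    -- The jump kernel is available only as s-finite, so boundedness does not make the slices
    -- integrable; integrability for almost every `q` comes from the joint law.
    filter_upwards [((Measure.integrable_compProd_iff G2m.aestronglyMeasurable).1 i2).1] with q hq
    by_cases hqt : τ q.1 ≤ t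
    · simp only [G1, G2, Φ, hqt, if_true, Kernel.comap_apply, excursionGain] at hq ⊢
      congr 1
      exact integral_switchKernel_of_support hlam Q q.2 hf hF
        (a := fun v => -f (q.2 (t - τ q.1)) + ((∫ w in (0 : ℝ)..(t - τ q.1 : ℝ≥0),
          g (q.2 w.toNNReal)) - ∫ w in (0 : ℝ)..v, g (q.2 w.toNNReal)))
        (measurable_const.add (measurable_const.sub
          ((CadlagPath.measurable_integral_eval hgm).comp
            (measurable_const.prodMk measurable_id)))) _ hq
    · simp [G1, G2, Φ, hqt]
  have iΦ : Integrable Φ (Pr.map fun ω => (past ω, ζ ω)) :=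
    (i1.add i3).congr hΦ
  rw [integral_congr_ae hΦ]
  rw [law1] at iΦ ⊢
  rw [Measure.integral_compProd iΦ]
  refine integral_eq_zero_of_ae (ae_of_all _ fun q => ?_)
  by_cases hqt : τ q ≤ t
  · simp only [Φ, hqt, if_true, Kernel.comap_apply]
    exact integral_excursion_eq_zero (P (x q)) hlam hC Q hf hh hF hH (hM _) _
  · simp [Φ, hqt]

/-! ### Waiting times -/

theorem lintegral_waitingTime {Ω 𝓗 : Type*} [MeasurableSpace Ω] [MeasurableSpace 𝓗]
    {Pr : Measure Ω} [IsProbabilityMeasure Pr] {d : ℕ} {lam : State d → ℝ≥0}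
    (hlam : Measurable lam) (Q : Kernel (State d) (State d)) [IsMarkovKernel Q]
    {past : Ω → 𝓗} {ζ : Ω → CadlagPath d} {Z : Ω → State d × ℝ≥0}
    (h2 : HasCondDistrib Z (fun ω => (past ω, ζ ω))
      ((switchKernel lam Q).comap (fun q : 𝓗 × CadlagPath d => q.2)
        (measurable_snd : Measurable fun q : 𝓗 × CadlagPath d => q.2)) Pr)
    {k : 𝓗 → ℝ≥0∞} (hk : Measurable k) {g : ℝ≥0 → ℝ≥0∞} (hg : Measurable g) :
    ∫⁻ ω, k (past ω) * g (Z ω).2 ∂Pr = ∫⁻ ω, (k (past ω) *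
      ∫⁻ v in Ici (0 : ℝ), ENNReal.ofReal (jumpDensity lam (ζ ω) v.toNNReal) * g v.toNNReal)
        ∂Pr := by
  have m1 : AEMeasurable (fun ω => (past ω, ζ ω)) Pr := h2.aemeasurable_fst
  have m2 : AEMeasurable (fun ω => ((past ω, ζ ω), Z ω)) Pr := HasLaw.aemeasurable h2
  have := Measure.isProbabilityMeasure_map m1
  have law2 := HasLaw.map_eq h2
  have hm : Measurable fun q : (𝓗 × CadlagPath d) × (State d × ℝ≥0) => k q.1.1 * g q.2.2 := by
    fun_prop
  have hm' : Measurable fun q : 𝓗 × CadlagPath d => k q.1 *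
      ∫⁻ v in Ici (0 : ℝ), ENNReal.ofReal (jumpDensity lam q.2 v.toNNReal) * g v.toNNReal := by
    refine (hk.comp measurable_fst).mul ?_
    refine Measurable.lintegral_prod_right' (f := fun p : (𝓗 × CadlagPath d) × ℝ =>
      ENNReal.ofReal (jumpDensity lam p.1.2 p.2.toNNReal) * g p.2.toNNReal) ?_
    exact ((measurable_jumpDensity hlam).comp
      (f := fun p : (𝓗 × CadlagPath d) × ℝ => (p.1.2, p.2.toNNReal)) (by fun_prop)).ennreal_ofReal
      |>.mul (by fun_prop)
  rw [← lintegral_map' (f := fun q : (𝓗 × CadlagPath d) × (State d × ℝ≥0) => k q.1.1 * g q.2.2)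
    hm.aemeasurable m2, law2, Measure.lintegral_compProd hm,
    ← lintegral_map' (f := fun q : 𝓗 × CadlagPath d => k q.1 *
      ∫⁻ v in Ici (0 : ℝ), ENNReal.ofReal (jumpDensity lam q.2 v.toNNReal) * g v.toNNReal)
    hm'.aemeasurable m1]
  refine lintegral_congr fun q => ?_
  simp only [Kernel.comap_apply]
  rw [lintegral_const_mul _ (by fun_prop), lintegral_switchKernel_snd hlam Q _ hg]

/-- Given the path, the waiting time has a density, so it has no atom at `0`. For a truncated
difference, positivity means that the jump times strictly increase. -/
theorem ae_waitingTime_pos {Ω 𝓗 : Type*} [MeasurableSpace Ω] [MeasurableSpace 𝓗]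
    {Pr : Measure Ω} [IsProbabilityMeasure Pr] {d : ℕ} {lam : State d → ℝ≥0}
    (hlam : Measurable lam) (Q : Kernel (State d) (State d)) [IsMarkovKernel Q]
    {past : Ω → 𝓗} {ζ : Ω → CadlagPath d} {Z : Ω → State d × ℝ≥0}
    (h2 : HasCondDistrib Z (fun ω => (past ω, ζ ω))
      ((switchKernel lam Q).comap (fun q : 𝓗 × CadlagPath d => q.2)
        (measurable_snd : Measurable fun q : 𝓗 × CadlagPath d => q.2)) Pr) :
    ∀ᵐ ω ∂Pr, 0 < (Z ω).2 := by
  have hg : Measurable (({0} : Set ℝ≥0).indicator (fun _ => (1 : ℝ≥0∞))) :=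
    measurable_const.indicator (measurableSet_singleton 0)
  have h := lintegral_waitingTime hlam Q h2 (k := fun _ => 1) measurable_const hg
  have h0 : ∀ ω, ∫⁻ v in Ici (0 : ℝ), ENNReal.ofReal (jumpDensity lam (ζ ω) v.toNNReal) *
      ({0} : Set ℝ≥0).indicator (fun _ => (1 : ℝ≥0∞)) v.toNNReal = 0 := fun ω => by
    refine (lintegral_congr_ae ?_).trans lintegral_zero
    have hne : ∀ᵐ v : ℝ, v ≠ 0 := by simp [ae_iff, measure_singleton]
    filter_upwards [ae_restrict_mem measurableSet_Ici, ae_restrict_of_ae hne] with v hv hv'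
    have : v.toNNReal ≠ 0 := by
      rw [Ne, Real.toNNReal_eq_zero, not_le]; exact lt_of_le_of_ne hv hv'.symm
    simp [this]
  simp only [h0, mul_zero, lintegral_zero, one_mul] at h
  have hZ : AEMeasurable Z Pr := h2.aemeasurable_snd
  filter_upwards [(lintegral_eq_zero_iff' (hg.comp_aemeasurable hZ.snd)).1 h] with ω hω
  refine pos_iff_ne_zero.2 fun h0 => ?_
  simp [h0] at hω

/-- The conditional density of the waiting time is at most `C`, so its Laplace transform at `θ` is
at most `∫ C exp(-θ v) dv = C / θ`, uniformly in the past. -/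
theorem lintegral_exp_neg_jumpTime_le {Ω 𝓗 : Type*} [MeasurableSpace Ω] [MeasurableSpace 𝓗]
    {Pr : Measure Ω} [IsProbabilityMeasure Pr] {d : ℕ} {lam : State d → ℝ≥0}
    (hlam : Measurable lam) {C : ℝ≥0} (hC : ∀ z, lam z ≤ C)
    (Q : Kernel (State d) (State d)) [IsMarkovKernel Q]
    {past : Ω → 𝓗} {τ : 𝓗 → ℝ≥0} (hτ : Measurable τ)
    {ζ : Ω → CadlagPath d} {Z : Ω → State d × ℝ≥0}
    (h2 : HasCondDistrib Z (fun ω => (past ω, ζ ω))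
      ((switchKernel lam Q).comap (fun q : 𝓗 × CadlagPath d => q.2)
        (measurable_snd : Measurable fun q : 𝓗 × CadlagPath d => q.2)) Pr)
    {θ : ℝ} (hθ : 0 < θ) :
    ∫⁻ ω, ENNReal.ofReal (Real.exp (-θ * (τ (past ω) + (Z ω).2 : ℝ≥0))) ∂Pr
      ≤ ENNReal.ofReal (C / θ) * ∫⁻ ω, ENNReal.ofReal (Real.exp (-θ * τ (past ω))) ∂Pr := by
  have hk : Measurable fun q : 𝓗 => ENNReal.ofReal (Real.exp (-θ * τ q)) := by fun_prop
  have hg : Measurable fun v : ℝ≥0 => ENNReal.ofReal (Real.exp (-θ * v)) := by fun_prop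
  have h := lintegral_waitingTime hlam Q h2 hk hg
  have hsplit : ∀ ω, ENNReal.ofReal (Real.exp (-θ * (τ (past ω) + (Z ω).2 : ℝ≥0)))
      = ENNReal.ofReal (Real.exp (-θ * τ (past ω)))
        * ENNReal.ofReal (Real.exp (-θ * (Z ω).2)) := fun ω => by
    rw [← ENNReal.ofReal_mul (Real.exp_pos _).le, ← Real.exp_add, NNReal.coe_add, mul_add]
  have hexp : ∫⁻ v in Ici (0 : ℝ), ENNReal.ofReal (C * Real.exp (-θ * v))
      = ENNReal.ofReal (C / θ) := by
    rw [setLIntegral_congr Ioi_ae_eq_Ici.symm, ← ofReal_integral_eq_lintegral_ofReal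
      ((integrableOn_exp_mul_Ioi (neg_neg_of_pos hθ) 0).const_mul _)
      (ae_of_all _ fun v => by positivity), integral_const_mul,
      integral_exp_mul_Ioi (neg_neg_of_pos hθ)]
    simp [div_eq_mul_inv]
  have hle : ∀ ω, ∫⁻ v in Ici (0 : ℝ), ENNReal.ofReal (jumpDensity lam (ζ ω) v.toNNReal) *
      ENNReal.ofReal (Real.exp (-θ * v.toNNReal)) ≤ ENNReal.ofReal (C / θ) := fun ω => by
    rw [← hexp]
    refine setLIntegral_mono' measurableSet_Ici fun v hv => ?_
    rw [← ENNReal.ofReal_mul (jumpDensity_nonneg _ _ _), Real.coe_toNNReal _ hv]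
    gcongr
    exact jumpDensity_le hC _ _
  simp only [hsplit]
  rw [h, ← lintegral_const_mul' _ _ ENNReal.ofReal_ne_top]
  refine lintegral_mono fun ω => ?_
  rw [mul_comm]
  gcongr
  exact hle ω

/-! ### Measurability of the switching process -/

theorem exists_le_lt_succ_of_tendsto_atTop {u : ℕ → ℝ≥0} (h0 : u 0 = 0)
    (hu : Tendsto u atTop atTop) (s : ℝ≥0) : ∃ n, u n ≤ s ∧ s < u (n + 1) := by
  have hex : ∃ n, s < u n := (hu.eventually_gt_atTop s).exists
  classical
  have h1 := Nat.find_spec hex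
  have hne : Nat.find hex ≠ 0 := fun h => by
    rw [h, h0] at h1; exact not_lt_zero h1
  obtain ⟨n, hn⟩ := Nat.exists_eq_succ_of_ne_zero hne
  refine ⟨n, not_lt.1 (Nat.find_min hex (by omega)), ?_⟩
  rwa [hn] at h1

/-- The path which follows `ζ k` from time `T k` on, for the last `k ≤ n` such that `T k` has
passed. -/
noncomputable def gluedPath {d : ℕ} (ζ : ℕ → CadlagPath d) (T : ℕ → ℝ≥0) : ℕ → ℝ≥0 → State d
  | 0, s => ζ 0 (s - T 0)
  | n + 1, s => if T (n + 1) ≤ s then ζ (n + 1) (s - T (n + 1)) else gluedPath ζ T n s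

theorem gluedPath_eq {d : ℕ} {ζ : ℕ → CadlagPath d} {T : ℕ → ℝ≥0} (hT : StrictMono T) {N : ℕ}
    {s : ℝ≥0} (h1 : T N ≤ s) (h2 : s < T (N + 1)) {n : ℕ} (hn : N ≤ n) :
    gluedPath ζ T n s = ζ N (s - T N) := by
  induction n, hn using Nat.le_induction with
  | base =>
    cases N with
    | zero => rfl
    | succ N => simp [gluedPath, h1]
  | succ n hn ih =>
    have : ¬ T (n + 1) ≤ s := not_le.2 (h2.trans_le (hT.monotone (by omega)))
    simp [gluedPath, this, ih]

theorem measurable_gluedPath {d : ℕ} {E : Type*} [MeasurableSpace E] {ζ : ℕ → E → CadlagPath d}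
    (hζ : ∀ n, Measurable (ζ n)) {T : ℕ → E → ℝ≥0} (hT : ∀ n, Measurable (T n)) {σ : E → ℝ≥0}
    (hσ : Measurable σ) (n : ℕ) :
    Measurable fun e => gluedPath (fun k => ζ k e) (fun k => T k e) n (σ e) := by
  have h : ∀ n, Measurable fun e => (ζ n e) (σ e - T n e) := fun n =>
    (CadlagPath.measurable_eval_prod d).comp ((hζ n).prodMk (hσ.sub (hT n)))
  induction n with
  | zero => exact h 0
  | succ n ih => exact Measurable.ite (measurableSet_le (hT _) hσ) (h _) ih

/-- No measurability of `Ψ` is assumed: it is recovered as an almost everywhere limit of glued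
paths, which stabilise once `n` passes the index of the current excursion. The map `φ` covers both a
fixed time (identity) and joint measurability on `Ω × ℝ` (first projection). -/
theorem aemeasurable_of_ae_follows {d : ℕ} {Ω E : Type*} [MeasurableSpace Ω] [MeasurableSpace E]
    {Pr : Measure Ω} {ζ : ℕ → Ω → CadlagPath d} (hζ : ∀ n, AEMeasurable (ζ n) Pr)
    {T : ℕ → Ω → ℝ≥0} (hT : ∀ n, AEMeasurable (T n) Pr) {Ψ : ℝ≥0 → Ω → State d}
    (h0 : ∀ᵐ ω ∂Pr, T 0 ω = 0) (hmono : ∀ᵐ ω ∂Pr, StrictMono fun n => T n ω)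
    (htop : ∀ᵐ ω ∂Pr, Tendsto (fun n => T n ω) atTop atTop)
    (hΨ : ∀ᵐ ω ∂Pr, ∀ n, ∀ t, T n ω ≤ t → t < T (n + 1) ω → Ψ t ω = ζ n ω (t - T n ω))
    {m : Measure E} {φ : E → Ω} (hφ : Measure.QuasiMeasurePreserving φ m Pr) {σ : E → ℝ≥0}
    (hσ : Measurable σ) : AEMeasurable (fun e => Ψ (σ e) (φ e)) m := by
  refine aemeasurable_of_tendsto_metrizable_ae' (fun n => (measurable_gluedPath
    (fun k => (hζ k).measurable_mk.comp hφ.measurable)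
    (fun k => (hT k).measurable_mk.comp hφ.measurable) hσ n).aemeasurable) ?_
  have e1 := ae_all_iff.2 fun k => (hζ k).ae_eq_mk
  have e2 := ae_all_iff.2 fun k => (hT k).ae_eq_mk
  filter_upwards [hφ.ae (h0.and (hmono.and (htop.and (hΨ.and (e1.and e2)))))]
    with e ⟨h0, hmono, htop, hΨ, e1, e2⟩
  obtain ⟨N, hN1, hN2⟩ := exists_le_lt_succ_of_tendsto_atTop h0 htop (σ e)
  simp only [Function.comp_apply, ← e1, ← e2]
  rw [hΨ N _ hN1 hN2]
  refine tendsto_const_nhds.congr' ?_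
  filter_upwards [eventually_ge_atTop N] with n hn
  exact (gluedPath_eq (ζ := fun k => ζ k (φ e)) hmono hN1 hN2 hn).symm

/-! ### Telescoping over excursions -/

theorem integral_follow_eq {d : ℕ} (g : State d → ℝ) {ψ : ℝ≥0 → State d} {ζ : CadlagPath d}
    {a b : ℝ≥0} (h : ∀ t, a ≤ t → t < b → ψ t = ζ (t - a)) {m : ℝ≥0} (ham : a ≤ m) (hmb : m ≤ b) :
    ∫ s in (a : ℝ)..m, g (ψ s.toNNReal)
      = ∫ w in (0 : ℝ)..(m - a : ℝ≥0), g (ζ w.toNNReal) := by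
  have h1 := intervalIntegral.integral_comp_sub_right (a := (a : ℝ)) (b := m)
    (fun w => g (ζ w.toNNReal)) (a : ℝ)
  rw [sub_self, ← NNReal.coe_sub ham] at h1
  rw [← h1]
  refine intervalIntegral.integral_congr_ae ?_
  -- If `m = b`, the process has already jumped at the right endpoint; this single point is
  -- discarded.
  have hne : ∀ᵐ v : ℝ, v ≠ m := by simp [ae_iff, measure_singleton]
  filter_upwards [hne] with s hs hmem
  rw [uIoc_of_le (NNReal.coe_le_coe.2 ham)] at hmem
  have hs0 : 0 ≤ s := a.coe_nonneg.trans hmem.1.le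
  lift s to ℝ≥0 using hs0
  have has : a ≤ s := by exact_mod_cast hmem.1.le
  have hsm : s < b := lt_of_lt_of_le (by exact_mod_cast lt_of_le_of_ne hmem.2 hs) hmb
  rw [Real.toNNReal_coe, h s has hsm, ← NNReal.coe_sub has, Real.toNNReal_coe]

/-- The Dynkin term follows `ζ` up to time `t` even beyond the jump; if the jump comes by then,
`excursionGain` removes the overshoot and puts in the new state. Without a jump no correction is
made, so the survival probability never has to be computed. -/
theorem excursion_increment {d : ℕ} (f g : State d → ℝ) {ψ : ℝ≥0 → State d} {ζ : CadlagPath d}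
    {y : State d} {a b : ℝ≥0} (hab : a < b) (h : ∀ t, a ≤ t → t < b → ψ t = ζ (t - a))
    (hb : ψ b = y) (t : ℝ≥0) :
    (if a ≤ t then dynkinProcess f g (t - a) ζ + excursionGain f g (t - a) ζ (y, b - a) else 0)
      = f (ψ (min t b)) - f (ψ (min t a))
        - ∫ s in ((min t a : ℝ≥0) : ℝ)..(min t b : ℝ≥0), g (ψ s.toNNReal) := by
  have ha : ψ a = ζ 0 := by rw [h a le_rfl hab, tsub_self]
  by_cases hat : a ≤ t
  · rw [if_pos hat, min_eq_right hat, ha]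
    -- At `t = b` the jump counts as done, in agreement with the `≤` in `excursionGain`.
    rcases lt_or_ge t b with htb | hbt
    · have : ¬ b - a ≤ t - a := by
        rw [not_le]; exact tsub_lt_tsub_right_of_le hat htb
      rw [min_eq_left htb.le, integral_follow_eq g h hat htb.le, h t hat htb]
      simp [dynkinProcess, excursionGain, this]
    · have : b - a ≤ t - a := tsub_le_tsub_right hbt a
      rw [min_eq_right hbt, integral_follow_eq g h hab.le le_rfl, hb]
      simp only [dynkinProcess, excursionGain, this, if_true]
      ring
  · have hta := (not_le.1 hat).le
    rw [if_neg hat, min_eq_left hta, min_eq_left (hta.trans hab.le)]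
    simp

theorem sum_excursion_increment {d : ℕ} (f g : State d → ℝ) {ψ : ℝ≥0 → State d}
    {ζ : ℕ → CadlagPath d} {Y : ℕ → State d} {T : ℕ → ℝ≥0} (h0 : T 0 = 0) (hT : StrictMono T)
    (h : ∀ n, (∀ t, T n ≤ t → t < T (n + 1) → ψ t = ζ n (t - T n)) ∧ ψ (T (n + 1)) = Y (n + 1))
    {t : ℝ≥0} (hi : IntervalIntegrable (fun s : ℝ => g (ψ s.toNNReal)) volume 0 t) (n : ℕ) :
    ∑ k ∈ Finset.range n, (if T k ≤ t then dynkinProcess f g (t - T k) (ζ k)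
        + excursionGain f g (t - T k) (ζ k) (Y (k + 1), T (k + 1) - T k) else 0)
      = f (ψ (min t (T n))) - f (ψ 0)
        - ∫ s in (0 : ℝ)..(min t (T n) : ℝ≥0), g (ψ s.toNNReal) := by
  have hsub : ∀ a b : ℝ≥0, a ≤ t → b ≤ t →
      IntervalIntegrable (fun s : ℝ => g (ψ s.toNNReal)) volume a b := fun a b ha hb => by
    refine hi.mono_set (uIcc_subset_uIcc ?_ ?_) <;> rw [uIcc_of_le t.coe_nonneg] <;>
      exact ⟨NNReal.coe_nonneg _, by exact_mod_cast ‹_›⟩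
  induction n with
  | zero => simp [h0]
  | succ n ih =>
    have hadd := intervalIntegral.integral_add_adjacent_intervals
      (hsub 0 (min t (T n)) zero_le (min_le_left _ _))
      (hsub (min t (T n)) (min t (T (n + 1))) (min_le_left _ _) (min_le_left _ _))
    rw [NNReal.coe_zero] at hadd
    rw [Finset.sum_range_succ, ih,
      excursion_increment f g (hT n.lt_add_one) (h n).1 (h n).2, ← hadd]
    ring

/-! ### Non-explosion -/

/-- The means of `exp(-θ T n)` decay geometrically, so their sum is finite, the random series
converges almost surely, and its terms tend to zero. -/
theorem tendsto_atTop_of_lintegral_exp_le {Ω : Type*} [MeasurableSpace Ω] {Pr : Measure Ω}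
    [IsProbabilityMeasure Pr] {T : ℕ → Ω → ℝ≥0} (hT : ∀ n, AEMeasurable (T n) Pr) {θ : ℝ}
    (hθ : 0 < θ) {r : ℝ≥0∞} (hr : r < 1)
    (h : ∀ n, ∫⁻ ω, ENNReal.ofReal (Real.exp (-θ * T (n + 1) ω)) ∂Pr
      ≤ r * ∫⁻ ω, ENNReal.ofReal (Real.exp (-θ * T n ω)) ∂Pr) :
    ∀ᵐ ω ∂Pr, Tendsto (fun n => T n ω) atTop atTop := by
  have hm : ∀ n, AEMeasurable (fun ω => ENNReal.ofReal (Real.exp (-θ * T n ω))) Pr := fun n =>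
    (by fun_prop : Measurable fun s : ℝ≥0 => ENNReal.ofReal (Real.exp (-θ * s))).comp_aemeasurable
      (hT n)
  have hpow : ∀ n, ∫⁻ ω, ENNReal.ofReal (Real.exp (-θ * T n ω)) ∂Pr ≤ r ^ n := fun n => by
    induction n with
    | zero =>
      calc _ ≤ ∫⁻ _, 1 ∂Pr := lintegral_mono fun ω => by
            rw [← ENNReal.ofReal_one]
            refine ENNReal.ofReal_le_ofReal (Real.exp_le_one_iff.2 ?_)
            nlinarith [(T 0 ω).coe_nonneg]
        _ = r ^ 0 := by simp
    | succ n ih =>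
      rw [pow_succ']
      exact (h n).trans (by gcongr)
  have hsum : ∫⁻ ω, ∑' n, ENNReal.ofReal (Real.exp (-θ * T n ω)) ∂Pr ≠ ∞ := by
    rw [lintegral_tsum hm]
    refine ne_top_of_le_ne_top ?_ (ENNReal.tsum_le_tsum hpow)
    rw [ENNReal.tsum_geometric]
    exact ENNReal.inv_ne_top.2 (tsub_pos_of_lt hr).ne'
  filter_upwards [ae_lt_top' (AEMeasurable.tsum hm) hsum] with ω hω
  have h1 := ENNReal.tendsto_atTop_zero_of_tsum_ne_top hω.ne
  have h2 : Tendsto (fun n => Real.exp (-θ * T n ω)) atTop (𝓝 0) := by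
    have := (ENNReal.tendsto_toReal ENNReal.zero_ne_top).comp h1
    simpa [Function.comp_def, ENNReal.toReal_ofReal (Real.exp_pos _).le] using this
  have h3 := Real.tendsto_exp_comp_nhds_zero.1 h2
  have h4 : Tendsto (fun n => (T n ω : ℝ)) atTop atTop := by
    have := (tendsto_neg_atBot_atTop.comp h3).const_mul_atTop (inv_pos.2 hθ)
    refine this.congr fun n => ?_
    simp only [Function.comp_apply]
    field_simp
  exact NNReal.tendsto_coe_atTop.1 h4

/-! ### The Dynkin formula -/

theorem mainTheorem7 {d : ℕ}
    -- the intrinsic process: `P x` is its law when it starts from `x`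
    (P : Kernel (State d) (CadlagPath d)) [IsMarkovKernel P]
    (hP : ∀ x, ∀ᵐ ζ ∂(P x), ζ 0 = x)
    -- the jump rate and the jump kernel
    (lam : State d → ℝ≥0) (hlam : Measurable lam) (hlam_bdd : ∃ C : ℝ≥0, ∀ z, lam z ≤ C)
    (hlam_int : ∀ x, ∀ᵐ ζ ∂(P x), ∫⁻ v in Ici (0 : ℝ), (lam (ζ v.toNNReal) : ℝ≥0∞) = ∞)
    (Q : Kernel (State d) (State d)) [IsMarkovKernel Q]
    -- the operator `𝒜` with domain `D`, on bounded Borel functions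
    (D : Set (State d → ℝ)) (A : D → State d → ℝ)
    (hD : ∀ f : D, Measurable f.1 ∧ ∃ C, ∀ z, |f.1 z| ≤ C)
    (hA : ∀ f : D, Measurable (A f) ∧ ∃ C, ∀ z, |A f z| ≤ C)
    (hmart : ∀ f : D, ∀ x, Martingale (dynkinProcess f.1 (A f)) (canonicalFiltration d) (P x))
    -- the switching process
    {Ω : Type*} [MeasurableSpace Ω] (Pr : Measure Ω) [IsProbabilityMeasure Pr]
    (μ₀ : Measure (State d)) (Ψ : ℝ≥0 → Ω → State d)
    (hΨ : IsSwitchingProcess Pr P lam Q μ₀ Ψ)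
    (f : D) (t : ℝ≥0) :
    (∀ s, Integrable (fun ω => f.1 (Ψ s ω)) Pr) ∧
    (∀ s, Integrable (fun ω => switchedGenerator lam Q f.1 (A f) (Ψ s ω)) Pr) ∧
    IntervalIntegrable (fun s : ℝ => ∫ ω, switchedGenerator lam Q f.1 (A f) (Ψ s.toNNReal ω) ∂Pr)
      volume 0 t ∧
    ∫ ω, f.1 (Ψ t ω) ∂Pr = ∫ ω, f.1 (Ψ 0 ω) ∂Pr
      + ∫ s in (0 : ℝ)..t, ∫ ω, switchedGenerator lam Q f.1 (A f) (Ψ s.toNNReal ω) ∂Pr := by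
  obtain ⟨C, hC⟩ := hlam_bdd
  obtain ⟨hf, F, hF⟩ := hD f
  obtain ⟨hh, H, hH⟩ := hA f
  obtain ⟨ζ, Y, T, -, hT0, hζ, hYT, hpath⟩ := hΨ
  set g := switchedGenerator lam Q f.1 (A f)
  have hg : Measurable g := measurable_switchedGenerator hlam Q hf hh
  obtain ⟨G, hG⟩ : ∃ G, ∀ z, |g z| ≤ G := ⟨_, abs_switchedGenerator_le hC Q hf hF hH⟩
  have hlast : ∀ n, Measurable fun q : History d n => q.2.2 (Fin.last n) := fun n => by fun_prop
  have hζm : ∀ n, AEMeasurable (ζ n) Pr := fun n => (hζ n).aemeasurable_snd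
  have hTm : ∀ n, AEMeasurable (T n) Pr := fun n =>
    (hlast n).comp_aemeasurable (hζ n).aemeasurable_fst
  have hpos : ∀ᵐ ω ∂Pr, ∀ n, T n ω < T (n + 1) ω := by
    refine ae_all_iff.2 fun n => ?_
    filter_upwards [ae_waitingTime_pos hlam Q (hYT n)] with ω hω
    exact tsub_pos_iff_lt.1 hω
  have hmono : ∀ᵐ ω ∂Pr, StrictMono fun n => T n ω :=
    hpos.mono fun ω hω => strictMono_nat_of_lt_succ hω
  have htop : ∀ᵐ ω ∂Pr, Tendsto (fun n => T n ω) atTop atTop := by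
    -- Any `θ > C` makes the ratio `C / θ` less than 1.
    have hθ : (0 : ℝ) < C + 1 := by positivity
    refine tendsto_atTop_of_lintegral_exp_le hTm hθ (r := ENNReal.ofReal (C / (C + 1))) ?_
      fun n => ?_
    · rw [ENNReal.ofReal_lt_one, div_lt_one hθ]; linarith
    · refine le_trans (le_of_eq ?_) (lintegral_exp_neg_jumpTime_le hlam hC Q (hlast n) (hYT n) hθ)
      refine lintegral_congr_ae ?_
      filter_upwards [hpos] with ω hω
      simp only [history, Fin.val_last]
      rw [add_tsub_cancel_of_le (hω n).le]
  have hΨs : ∀ s, AEMeasurable (Ψ s) Pr := fun s =>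
    aemeasurable_of_ae_follows hζm hTm hT0 hmono htop
      (hpath.mono fun ω h n => (h n).1) (.id Pr) measurable_const
  have hfi : ∀ s, Integrable (fun ω => f.1 (Ψ s ω)) Pr := fun s =>
    Integrable.mono' (integrable_const F) (hf.comp_aemeasurable (hΨs s)).aestronglyMeasurable
      (ae_of_all _ fun _ => hF _)
  have hgi : ∀ s, Integrable (fun ω => g (Ψ s ω)) Pr := fun s =>
    Integrable.mono' (integrable_const G) (hg.comp_aemeasurable (hΨs s)).aestronglyMeasurable
      (ae_of_all _ fun _ => hG _)
  -- Joint integrability serves three times: for integrability in time of the mean, along almost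
  -- every trajectory, and for the final Fubini exchange.
  have hjoint : Integrable (fun p : Ω × ℝ => g (Ψ p.2.toNNReal p.1))
      (Pr.prod (volume.restrict (Ioc (0 : ℝ) t))) :=
    Integrable.mono' (integrable_const G) (hg.comp_aemeasurable
      (aemeasurable_of_ae_follows hζm hTm hT0 hmono htop (hpath.mono fun ω h n => (h n).1)
        Measure.quasiMeasurePreserving_fst
        (measurable_real_toNNReal.comp measurable_snd))).aestronglyMeasurable
      (ae_of_all _ fun _ => hG _)
  refine ⟨hfi, hgi, ?_, ?_⟩
  · rw [intervalIntegrable_iff_integrableOn_Ioc_of_le t.coe_nonneg]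
    exact hjoint.integral_prod_right
  let gain : ℕ → Ω → ℝ := fun n ω => if T n ω ≤ t then
    dynkinProcess f.1 g (t - T n ω) (ζ n ω) + excursionGain f.1 g (t - T n ω) (ζ n ω)
      (Y (n + 1) ω, T (n + 1) ω - T n ω) else 0
  have hgain : ∀ n, Integrable (gain n) Pr ∧ ∫ ω, gain n ω ∂Pr = 0 := fun n =>
    integrable_and_integral_excursion hlam hC Q hf hh hF hH (hmart f)
      (History.measurable_last d n) (hlast n) (hζ n) (hYT n) t
  have hsum : ∀ᵐ ω ∂Pr, ∀ n, ∑ k ∈ Finset.range n, gain k ω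
      = f.1 (Ψ (min t (T n ω)) ω) - f.1 (Ψ 0 ω)
        - ∫ s in (0 : ℝ)..(min t (T n ω) : ℝ≥0), g (Ψ s.toNNReal ω) := by
    filter_upwards [hT0, hmono, hpath, hjoint.prod_right_ae] with ω h0 hm hp hi n
    exact sum_excursion_increment f.1 g (ψ := fun s => Ψ s ω) (ζ := fun n => ζ n ω)
      (Y := fun n => Y n ω) (T := fun n => T n ω) h0 hm hp
      ((intervalIntegrable_iff_integrableOn_Ioc_of_le t.coe_nonneg).2 hi) n
  -- After telescoping, the partial sums are bounded by `2F + Gt` whatever `n`, and they are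
  -- constant once `T n ≥ t`.
  have hlim : Tendsto (fun n => ∫ ω, ∑ k ∈ Finset.range n, gain k ω ∂Pr) atTop
      (𝓝 (∫ ω, (f.1 (Ψ t ω) - f.1 (Ψ 0 ω) - ∫ s in (0 : ℝ)..t, g (Ψ s.toNNReal ω)) ∂Pr)) := by
    refine tendsto_integral_of_dominated_convergence (fun _ => F + F + G * t)
      (fun n => (integrable_finsetSum _ fun k _ => (hgain k).1).aestronglyMeasurable)
      (integrable_const _) (fun n => ?_) ?_
    · filter_upwards [hsum] with ω hω
      rw [hω n]
      have hG0 : 0 ≤ G := (abs_nonneg _).trans (hG 0)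
      have h1 := intervalIntegral.norm_integral_le_of_norm_le_const (a := (0 : ℝ))
        (b := (min t (T n ω) : ℝ≥0)) (f := fun s => g (Ψ s.toNNReal ω)) (C := G)
        fun s _ => hG _
      rw [sub_zero, NNReal.abs_eq] at h1
      have h2 : ((min t (T n ω) : ℝ≥0) : ℝ) ≤ t := NNReal.coe_le_coe.2 (min_le_left _ _)
      refine (norm_sub_le _ _).trans (add_le_add ((norm_sub_le _ _).trans
        (add_le_add (hF _) (hF _))) (h1.trans (mul_le_mul_of_nonneg_left h2 hG0)))
    · filter_upwards [hsum, htop] with ω hω htop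
      refine tendsto_const_nhds.congr' ?_
      filter_upwards [htop.eventually_ge_atTop t] with n hn
      rw [hω n, min_eq_left hn]
  have hzero : ∀ n, ∫ ω, ∑ k ∈ Finset.range n, gain k ω ∂Pr = 0 := fun n => by
    rw [integral_finsetSum _ fun k _ => (hgain k).1]
    exact Finset.sum_eq_zero fun k _ => (hgain k).2
  simp only [hzero] at hlim
  have hint : Integrable (fun ω => ∫ s in (0 : ℝ)..t, g (Ψ s.toNNReal ω)) Pr := by
    simp only [intervalIntegral.integral_of_le t.coe_nonneg]
    exact hjoint.integral_prod_left
  have hfinal := tendsto_nhds_unique tendsto_const_nhds hlim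
  have hdiff : Integrable (fun ω => f.1 (Ψ t ω) - f.1 (Ψ 0 ω)) Pr := (hfi t).sub (hfi 0)
  rw [integral_sub hdiff hint, integral_sub (hfi t) (hfi 0)] at hfinal
  have hswap : ∫ ω, (∫ s in (0 : ℝ)..t, g (Ψ s.toNNReal ω)) ∂Pr
      = ∫ s in (0 : ℝ)..t, ∫ ω, g (Ψ s.toNNReal ω) ∂Pr := by
    simp only [intervalIntegral.integral_of_le t.coe_nonneg]
    exact integral_integral_swap hjoint
  linarith
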